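/- **Setting.** Let $n\ge 1$, $\sigma>0$, and let $Y[t]=X^\star[t]+\varepsilon[t]$, $t=1,\dots,n$, with deterministic $X^\star[t]\in\mathbb{R}^p$ and independent $\varepsilon[t]\sim\mathcal N(0,\sigma^2 I_{p\times p})$. Let $\tau^\star=\{t\in\{1,\dots,n-1\}: X^\star[t]\ne X^\star[t+1]\}$ be the set of change-points, $\Delta_{\min}=\min_{t\in\tau^\star}\|X^\star[t]-X^\star[t+1]\|_2$, and $T_{\min}=\min\{|s-t|: s,t\in\tau^\star, s\neq t\}$. (If $\tau^\star$ is empty, $\Delta_{\min}$ may be any real number, and if $|\tau^\star|\le 1$, $T_{\min}$ may be any non-negative integer, such that the hypotheses below hold.) Let $\mathcal C\subset\mathbb{R}^p$ be a convex set with the origin in its interior, let $\|X\|_{\mathcal C}=\inf\{t>0: X\in t\,\mathcal C\}$ be its Minkowski functional, and let $\partial\|X\|_{\mathcal C}$ be the subdifferential of this function at $X$. For $\lambda\ge 0$ put $$M(\lambda)=\max_{1\le t\le n}\ \mathbb{E}_{g\sim\mathcal N(0,I_{p\times p})}\bigl[\mathrm{dist}(g,\lambda\cdot\partial\|X^\star[t]\|_{\mathcal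 C})\bigr],\qquad \eta=\eta_{\mathcal C}(\mathcal X)=\inf_{\lambda\ge 0}M(\lambda).$$ **Algorithm.** Input: $Y[1],\dots,Y[n]$, the set $\mathcal C$, an integer window length $\theta\ge 1$, a threshold $\gamma$, and $\lambda\ge 0$. 1. $\bar Y[i]=\frac1\theta\sum_{t=i}^{i+\theta-1}Y[t]$ for $1\le i\le n-\theta+1$. 2. $\hat X[i]=\arg\min_{X\in\mathbb{R}^p}\frac12\|\bar Y[i]-X\|_2^2+\lambda\|X\|_{\mathcal C}$. 3. $S[t]=\|\hat X[t+1]-\hat X[t-\theta+1]\|_2$ for $\theta\le t\le n-\theta$. 4. Set $S[t]=0$ whenever $S[t]<\gamma$. 5. Split the indices $t$ with $S[t]\ne 0$ into maximal groups in which consecutive indices are at most $\theta$ apart. The output $\hat\tau$ consists of one index from each group, at which $S$ is largest in that group (ties broken arbitrarily). **Theorem.** Suppose that for some $r>1$ $$\Delta_{\min}^2T_{\min}\ \ge\ 64\,\sigma^2\bigl(\eta+r\sqrt{2\log n}\bigr)^2$$ and that $T_{\min}/4\le t\le n-T_{\min}/4$ for every $t\in\tau^\star$. Let the parameters satisfy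 1. $\theta\le T_{\min}/4$; 2. $2\frac{\sigma}{\sqrt\theta}\bigl(\eta+r\sqrt{2\log n}\bigr)\le\gamma\le\Delta_{\min}/2$; 3. $\lambda=\frac{\sigma}{\sqrt\theta}\lambda_0$, where $\lambda_0\ge 0$ is a minimizer of $M$ over $[0,\infty)$. Then, with probability greater than $1-5n^{1-r^2}$, every output $\hat\tau$ of the algorithm satisfies both 1. $|\hat\tau|=|\tau^\star|$, and 2. $|\hat t_i-t_i^\star|\le\min\Bigl\{\Bigl(\frac{4r\sqrt{\log n}}{\eta}+4\Bigr)\frac{\sigma\,\eta}{\Delta_{\min}}\sqrt\theta,\ \theta\Bigr\}$ for all $i$, where $\hat t_i$ and $t_i^\star$ are the $i$-th elements of $\hat\tau$ and $\tau^\star$ in increasing order. -/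

import Mathlib

open MeasureTheory ProbabilityTheory

namespace ChangePoint

noncomputable section

/-- The signal space `ℝᵖ` with its Euclidean norm. -/
abbrev Vec (p : ℕ) : Type := EuclideanSpace ℝ (Fin p)

/-! ### Minkowski functional, Gaussian distance, proximal operator -/

/-- Subdifferential at `x` of a function `f` on `ℝᵖ`. -/
def subdiff {p : ℕ} (f : Vec p → ℝ) (x : Vec p) : Set (Vec p) :=
  {w | ∀ z, f x + inner ℝ w (z - x) ≤ f z}

open scoped Pointwise in
/-- `𝔼 dist(g, lam • ∂‖x‖_C)` for a standard Gaussian vector `g` in `ℝᵖ`, where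
`‖x‖_C = inf {t > 0 : x ∈ t • C}` is the Minkowski functional `gauge C` of `C`. -/
def expDist {p : ℕ} (C : Set (Vec p)) (x : Vec p) (lam : ℝ) : ℝ :=
  ∫ g, Metric.infDist g (lam • subdiff (gauge C) x) ∂(multivariateGaussian (0 : Vec p) 1)

/-- `max_{1 ≤ t ≤ n} 𝔼 dist(g, lam • ∂‖X[t]‖_C)` (the maximum is over a finite set, which is
nonempty for `n ≥ 1`). -/
def maxExpDist {p : ℕ} (C : Set (Vec p)) (X : ℕ → Vec p) (n : ℕ) (lam : ℝ) : ℝ :=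
  sSup ((fun t => expDist C (X t) lam) '' Set.Icc 1 n)

/-- The Gaussian distance `η_C({X[1], …, X[n]})`, the infimum over `lam ≥ 0`. -/
def gaussianDistance {p : ℕ} (C : Set (Vec p)) (X : ℕ → Vec p) (n : ℕ) : ℝ :=
  sInf (maxExpDist C X n '' Set.Ici 0)

/-- The objective function of the proximal denoiser. -/
def proxObj {p : ℕ} (C : Set (Vec p)) (lam : ℝ) (y x : Vec p) : ℝ :=
  1 / 2 * ‖y - x‖ ^ 2 + lam * gauge C x

/-- The proximal denoiser `argmin_x ½‖y - x‖² + lam ‖x‖_C`. -/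
def prox {p : ℕ} (C : Set (Vec p)) (lam : ℝ) (y : Vec p) : Vec p :=
  Classical.epsilon fun x => ∀ z, proxObj C lam y x ≤ proxObj C lam y z

/-- The minimum defining `prox` is attained. -/
theorem prox_spec {p : ℕ} {C : Set (Vec p)} (hC : Convex ℝ C) (h0 : (0 : Vec p) ∈ interior C)
    {lam : ℝ} (hlam : 0 ≤ lam) (y z : Vec p) :
    proxObj C lam y (prox C lam y) ≤ proxObj C lam y z := by
  have hex : ∃ x, ∀ z, proxObj C lam y x ≤ proxObj C lam y z := by
    have hg : Continuous (gauge C) := continuous_gauge hC (mem_interior_iff_mem_nhds.1 h0)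
    have hcont : Continuous (proxObj C lam y) := by
      unfold proxObj
      fun_prop
    refine hcont.exists_forall_le ?_
    have h1 : Filter.Tendsto (fun x : Vec p => ‖x‖ - ‖y‖ - 1)
        (Filter.cocompact (Vec p)) Filter.atTop :=
      Filter.tendsto_atTop_add_const_right _ _
        (Filter.tendsto_atTop_add_const_right _ _ (tendsto_norm_cocompact_atTop (E := Vec p)))
    refine Filter.tendsto_atTop_mono (fun x => ?_) h1
    have h2 : ‖x‖ - ‖y‖ ≤ ‖y - x‖ := by
      rw [norm_sub_rev]; exact norm_sub_norm_le x y
    have h3 : 0 ≤ lam * gauge C x := mul_nonneg hlam (gauge_nonneg x)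
    unfold proxObj
    nlinarith [sq_nonneg (‖y - x‖ - 1)]
  exact Classical.epsilon_spec hex z

/-! ### The change-point estimation algorithm -/

/-- Filtering: the sample mean of `Y[i], …, Y[i + θ - 1]`. -/
def windowMean {p : ℕ} (θ : ℕ) (Y : ℕ → Vec p) (i : ℕ) : Vec p :=
  (θ : ℝ)⁻¹ • ∑ t ∈ Finset.Ico i (i + θ), Y t

/-- Denoising: the proximal denoiser applied to the window means. -/
def denoised {p : ℕ} (C : Set (Vec p)) (θ : ℕ) (lam : ℝ) (Y : ℕ → Vec p) (i : ℕ) : Vec p :=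
  prox C lam (windowMean θ Y i)

/-- Differencing: `‖X̂[t + 1] - X̂[t - θ + 1]‖`, used for `θ ≤ t ≤ n - θ` only. -/
def diffStat {p : ℕ} (C : Set (Vec p)) (θ : ℕ) (lam : ℝ) (Y : ℕ → Vec p) (t : ℕ) : ℝ :=
  ‖denoised C θ lam Y (t + 1) - denoised C θ lam Y (t + 1 - θ)‖

/-- Thresholding: values below `γ` are set to `0`. -/
def threshStat {p : ℕ} (C : Set (Vec p)) (θ : ℕ) (γ lam : ℝ) (Y : ℕ → Vec p) (t : ℕ) : ℝ :=
  open Classical in if diffStat C θ lam Y t < γ then 0 else diffStat C θ lam Y t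

/-- The indices `θ ≤ t ≤ n - θ` of the nonzero entries of `S`. -/
def nonzeroIdx (S : ℕ → ℝ) (n θ : ℕ) : Finset ℕ :=
  open Classical in (Finset.Icc θ (n - θ)).filter fun t => S t ≠ 0

/-- The group of `t` in `D`: all elements of `D` reachable from `t` by moving inside `D` with
steps of length at most `θ`. -/
def groupOf (D : Finset ℕ) (θ t : ℕ) : Finset ℕ :=
  open Classical in D.filter fun s =>
    Relation.ReflTransGen (fun a b => a ∈ D ∧ b ∈ D ∧ a ≤ b + θ ∧ b ≤ a + θ) t s

/-- The groups into which `D` splits: the maximal subsets of `D` in which consecutive elements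
are at most `θ` apart. -/
def groups (D : Finset ℕ) (θ : ℕ) : Finset (Finset ℕ) :=
  open Classical in D.image (groupOf D θ)

/-- `T` consists of one index from each group, at which `S` is largest in that group
(ties may be broken in any way). -/
def IsSelection (S : ℕ → ℝ) (D : Finset ℕ) (θ : ℕ) (T : Finset ℕ) : Prop :=
  ∃ pick : Finset ℕ → ℕ,
    (∀ g ∈ groups D θ, pick g ∈ g ∧ ∀ s ∈ g, S s ≤ S (pick g)) ∧
      T = (groups D θ).image pick

/-- `T` is an output of the algorithm on the observations `Y[1], …, Y[n]`, for the convex set `C`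
and the parameters `θ, γ, lam`. -/
def IsOutput {p : ℕ} (C : Set (Vec p)) (n θ : ℕ) (γ lam : ℝ) (Y : ℕ → Vec p)
    (T : Finset ℕ) : Prop :=
  IsSelection (threshStat C θ γ lam Y) (nonzeroIdx (threshStat C θ γ lam Y) n θ) θ T

/-- The algorithm always has an output. -/
theorem exists_isOutput {p : ℕ} (C : Set (Vec p)) (n θ : ℕ) (γ lam : ℝ) (Y : ℕ → Vec p) :
    ∃ T, IsOutput C n θ γ lam Y T := by
  classical
  have key : ∀ g : Finset ℕ, ∃ t, g.Nonempty →
      t ∈ g ∧ ∀ s ∈ g, threshStat C θ γ lam Y s ≤ threshStat C θ γ lam Y t := by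
    intro g
    by_cases hg : g.Nonempty
    · obtain ⟨t, ht, h⟩ := g.exists_max_image (threshStat C θ γ lam Y) hg
      exact ⟨t, fun _ => ⟨ht, h⟩⟩
    · exact ⟨0, fun h => absurd h hg⟩
  choose pick hpick using key
  refine ⟨_, pick, fun g hg => hpick g ?_, rfl⟩
  obtain ⟨t, ht, rfl⟩ := Finset.mem_image.1 hg
  exact ⟨t, Finset.mem_filter.2 ⟨ht, Relation.ReflTransGen.refl⟩⟩

/-! ### The change-points -/

/-- The change-points of `X[1], …, X[n]`. -/
def changePoints {p : ℕ} (X : ℕ → Vec p) (n : ℕ) : Finset ℕ :=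
  open Classical in (Finset.Ico 1 n).filter fun t => X t ≠ X (t + 1)

/-- The sizes of the changes. -/
def jumpSizes {p : ℕ} (X : ℕ → Vec p) (n : ℕ) : Set ℝ :=
  (fun t => ‖X t - X (t + 1)‖) '' (changePoints X n : Set ℕ)

/-- The distances between distinct change-points. -/
def changeGaps {p : ℕ} (X : ℕ → Vec p) (n : ℕ) : Set ℕ :=
  {d | ∃ s ∈ changePoints X n, ∃ t ∈ changePoints X n, s < t ∧ d = t - s}

end

end ChangePoint

/-! A deterministic estimate holds on an event of noise realizations, and Gaussian concentration
makes that event likely.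

Deterministic side: the proximal map is nonexpansive, and denoising `x + e` errs by at most the
distance from `e` to `lam • ∂‖x‖_C`. So the statistic at `t` differs from the true jump at `t` by
less than a noise level `b` plus the biases of the two windows (`abs_diffStat_sub_lt`). With
change-points at least `4θ` apart, the statistic is below `b` at distance at least `θ` from all of
them, above jump minus `b` at each of them, and below `b + (1 - |t - s|/θ)` times the jump at a
nearby `t ≠ s`. As `b ≤ γ ≤ Δ/2`, thresholding keeps every change-point and only indices less than
`θ` from one, so the groups correspond to the change-points. A maximizer `t` in the group of `s`
beats `s` only if `|t - s| ≤ 2bθ/Δ`.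

Probabilistic side: the two windows at `t` carry independent Gaussian noise, and a distance function
is `1`-Lipschitz. The sum of the two distances is therefore sub-Gaussian around a mean of at most
`2η`, in units of `σ/√θ`. A deviation `2r√(log n)` has probability at most `n ^ (-r²)`, and a union
bound over at most `n` indices gives `n ^ (1 - r²)`. With this `b`, `2bθ/Δ` is exactly the stated
localization bound.

Concentration with variance proxy `1` (`hasSubgaussianMGF_of_lipschitzWith`) is proved by rotating
between two independent Gaussian copies, which bounds the covariance of `f` and `exp (s f)`, and
then integrating the resulting differential inequality for the moment generating function. -/

namespace ChangePoint

/-! ### Integrability and integration by parts under the standard Gaussian measure -/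

section GaussianConcentration

open scoped RealInnerProductSpace

theorem pi_absolutelyContinuous : ∀ {d : ℕ} {μ ν : Fin d → Measure ℝ}
    [∀ i, SigmaFinite (μ i)] [∀ i, SigmaFinite (ν i)],
    (∀ i, μ i ≪ ν i) → Measure.pi μ ≪ Measure.pi ν := by
  intro d
  induction d with
  | zero =>
    intro μ ν _ _ _
    rw [Measure.pi_of_empty μ, Measure.pi_of_empty ν]
  | succ d ih =>
    intro μ ν _ _ h
    have h1 := (measurePreserving_piFinSuccAbove μ 0).symm.map_eq
    have h2 := (measurePreserving_piFinSuccAbove ν 0).symm.map_eq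
    rw [← h1, ← h2]
    exact ((h 0).prod (ih fun i => h _)).map (MeasurableEquiv.measurable _)

/-- Transfers Rademacher's theorem, an almost-everywhere statement for Lebesgue measure, to the
Gaussian measure. -/
theorem stdGaussian_absolutelyContinuous (p : ℕ) :
    stdGaussian (Vec p) ≪ volume := by
  rw [← map_pi_eq_stdGaussian,
    ← (EuclideanSpace.volume_preserving_symm_measurableEquiv_toLp (Fin p)).symm.map_eq]
  exact (pi_absolutelyContinuous fun _ => gaussianReal_absolutelyContinuous 0 one_ne_zero).map
    (by fun_prop)

variable {p : ℕ}

/-- Fernique's theorem gives an integrable `exp (C‖x‖²)`; completing the square dominates `exp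
(c‖x‖)` by a multiple of it. -/
theorem integrable_exp_mul_norm_stdGaussian (c : ℝ) :
    Integrable (fun x => Real.exp (c * ‖x‖)) (stdGaussian (Vec p)) := by
  obtain ⟨C, hC, h⟩ := IsGaussian.exists_integrable_exp_sq (stdGaussian (Vec p))
  refine (h.const_mul (Real.exp (c ^ 2 / (4 * C)))).mono' (by fun_prop) (ae_of_all _ fun x => ?_)
  rw [Real.norm_of_nonneg (Real.exp_nonneg _), ← Real.exp_add, Real.exp_le_exp]
  have h1 : c ^ 2 / (4 * C) + C * ‖x‖ ^ 2 - c * ‖x‖ = (c - 2 * C * ‖x‖) ^ 2 / (4 * C) := by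
    field_simp
    ring
  have h2 : 0 ≤ (c - 2 * C * ‖x‖) ^ 2 / (4 * C) := by positivity
  linarith

theorem integrable_of_le_exp_norm {g : Vec p → ℝ}
    (hg : AEStronglyMeasurable g (stdGaussian (Vec p))) (A c : ℝ)
    (h : ∀ x, |g x| ≤ A * Real.exp (c * ‖x‖)) : Integrable g (stdGaussian (Vec p)) :=
  ((integrable_exp_mul_norm_stdGaussian c).const_mul A).mono' hg (ae_of_all _ h)

theorem integrable_prod_of_le_exp_norm {g : Vec p × Vec p → ℝ}
    (hg : AEStronglyMeasurable g ((stdGaussian (Vec p)).prod (stdGaussian (Vec p)))) (A c : ℝ)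
    (h : ∀ z, |g z| ≤ A * Real.exp (c * (‖z.1‖ + ‖z.2‖))) :
    Integrable g ((stdGaussian (Vec p)).prod (stdGaussian (Vec p))) := by
  refine (((integrable_exp_mul_norm_stdGaussian c).mul_prod
    (integrable_exp_mul_norm_stdGaussian c)).const_mul A).mono' hg (ae_of_all _ fun z => ?_)
  rw [← Real.exp_add, ← mul_add]
  exact h z

theorem abs_le_of_lipschitzWith {K : NNReal} {f : Vec p → ℝ} (hf : LipschitzWith K f) (x : Vec p) :
    |f x| ≤ |f 0| + K * ‖x‖ := by
  have h1 := hf.dist_le_mul x 0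
  rw [Real.dist_eq, dist_zero_right] at h1
  have h2 := abs_sub_abs_le_abs_sub (f x) (f 0)
  linarith

theorem abs_le_exp_of_lipschitzWith {K : NNReal} {f : Vec p → ℝ} (hf : LipschitzWith K f)
    (x : Vec p) : |f x| ≤ Real.exp |f 0| * Real.exp (K * ‖x‖) := by
  rw [← Real.exp_add]
  have := Real.add_one_le_exp (|f 0| + K * ‖x‖)
  linarith [abs_le_of_lipschitzWith hf x]

theorem integrable_of_lipschitzWith {K : NNReal} {f : Vec p → ℝ} (hf : LipschitzWith K f) :
    Integrable f (stdGaussian (Vec p)) :=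
  integrable_of_le_exp_norm hf.continuous.aestronglyMeasurable _ _ (abs_le_exp_of_lipschitzWith hf)

theorem integrable_exp_mul_of_lipschitzWith {K : NNReal} {f : Vec p → ℝ} (hf : LipschitzWith K f)
    (s : ℝ) : Integrable (fun x => Real.exp (s * f x)) (stdGaussian (Vec p)) := by
  have := hf.continuous
  refine integrable_of_le_exp_norm (by fun_prop) (Real.exp (|s| * |f 0|)) (|s| * K) fun x => ?_
  rw [abs_of_nonneg (Real.exp_nonneg _), ← Real.exp_add, Real.exp_le_exp]
  calc s * f x ≤ |s| * |f x| := by rw [← abs_mul]; exact le_abs_self _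
    _ ≤ |s| * (|f 0| + K * ‖x‖) := by gcongr; exact abs_le_of_lipschitzWith hf x
    _ = _ := by ring

theorem integral_inner_sq_stdGaussian (v : Vec p) :
    ∫ y, ⟪v, y⟫ ^ 2 ∂(stdGaussian (Vec p)) = ‖v‖ ^ 2 := by
  have h := variance_dual_stdGaussian (E := Vec p) (innerSL ℝ v)
  rw [innerSL_apply_norm, variance_of_integral_eq_zero (by fun_prop)
    (integral_strongDual_stdGaussian _)] at h
  simpa using h

/-- Gaussian integration by parts in the form of a bound, for Lipschitz functions. -/
theorem abs_integral_inner_mul_le {K : NNReal} {k : Vec p → ℝ} (hk : LipschitzWith K k)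
    (v : Vec p) : |∫ y, ⟪v, y⟫ * k y ∂(stdGaussian (Vec p))| ≤ K * ‖v‖ := by
  rcases eq_or_ne v 0 with rfl | hv
  · simp
  have hv' : 0 < ‖v‖ := norm_pos_iff.2 hv
  have hkc := hk.continuous
  have hint : Integrable (fun y => ⟪v, y⟫ * k y) (stdGaussian (Vec p)) := by
    refine integrable_of_le_exp_norm (by fun_prop) (Real.exp (|k 0|)) (‖v‖ + K) fun y => ?_
    rw [abs_mul, add_mul, Real.exp_add]
    calc |⟪v, y⟫| * |k y| ≤ Real.exp (‖v‖ * ‖y‖) * (Real.exp |k 0| * Real.exp (K * ‖y‖)) := by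
          gcongr
          · have := Real.add_one_le_exp (‖v‖ * ‖y‖)
            linarith [abs_real_inner_le_norm v y]
          · exact abs_le_exp_of_lipschitzWith hk y
      _ = _ := by ring
  -- Reflection in the hyperplane orthogonal to `v` preserves the measure and flips the sign of `⟪v,
  -- y⟫`. Averaging replaces `k y` by half of `k y - k (R y)`, and `y - R y` has norm `2|⟪v,
  -- y⟫|/‖v‖`, so only the second moment of `⟪v, y⟫` remains.
  set R : Vec p ≃ₗᵢ[ℝ] Vec p := (ℝ ∙ v)ᗮ.reflection with hR
  have hRv : ∀ y, R y = y - (2 * (⟪v, y⟫ / ‖v‖ ^ 2)) • v := by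
    intro y
    rw [hR, Submodule.reflection_orthogonal_apply, Submodule.reflection_singleton_apply]
    simp only [RCLike.ofReal_real_eq_id, id, mul_smul, neg_sub, two_smul]
  have hin : ∀ y, ⟪v, R y⟫ = -⟪v, y⟫ := by
    intro y
    rw [hRv, inner_sub_right, inner_smul_right, real_inner_self_eq_norm_sq]
    field_simp
    ring
  have hmp : MeasurePreserving R (stdGaussian (Vec p)) (stdGaussian (Vec p)) :=
    ⟨R.continuous.measurable, stdGaussian_map R⟩
  have h1 : ∫ y, ⟪v, y⟫ * k y ∂(stdGaussian (Vec p))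
      = ∫ y, -⟪v, y⟫ * k (R y) ∂(stdGaussian (Vec p)) := by
    rw [← hmp.integral_comp R.toHomeomorph.measurableEmbedding]
    simp_rw [hin]
  have hint2 : Integrable (fun y => -⟪v, y⟫ * k (R y)) (stdGaussian (Vec p)) := by
    have := hmp.integrable_comp_of_integrable hint
    simpa only [Function.comp_def, hin] using this
  have h2 : 2 * ∫ y, ⟪v, y⟫ * k y ∂(stdGaussian (Vec p))
      = ∫ y, ⟪v, y⟫ * (k y - k (R y)) ∂(stdGaussian (Vec p)) := by
    rw [two_mul]
    conv_lhs => rw [h1]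
    nth_rw 1 [← h1]
    rw [← integral_add hint hint2]
    congr 1
    ext y
    ring
  have h3 : |∫ y, ⟪v, y⟫ * (k y - k (R y)) ∂(stdGaussian (Vec p))|
      ≤ ∫ y, (2 * K / ‖v‖) * ⟪v, y⟫ ^ 2 ∂(stdGaussian (Vec p)) := by
    rw [← Real.norm_eq_abs]
    refine norm_integral_le_of_norm_le ?_ (ae_of_all _ fun y => ?_)
    · refine Integrable.const_mul ?_ _
      exact (IsGaussian.memLp_dual (stdGaussian (Vec p)) (innerSL ℝ v) 2 (by simp)).integrable_sq
    · rw [norm_mul, Real.norm_eq_abs, ← dist_eq_norm]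
      have h4 := hk.dist_le_mul y (R y)
      rw [dist_eq_norm y, hRv y, sub_sub_cancel, norm_smul, Real.norm_eq_abs] at h4
      rw [hRv y]
      calc |⟪v, y⟫| * dist (k y) (k (y - (2 * (⟪v, y⟫ / ‖v‖ ^ 2)) • v))
          ≤ |⟪v, y⟫| * (K * (|2 * (⟪v, y⟫ / ‖v‖ ^ 2)| * ‖v‖)) := by gcongr
        _ = _ := by
          rw [abs_mul, abs_div, abs_of_pos (by positivity : (0:ℝ) < ‖v‖ ^ 2), abs_two,
            ← sq_abs ⟪v, y⟫]
          field_simp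
  rw [integral_const_mul, integral_inner_sq_stdGaussian, ← h2, abs_mul, abs_two] at h3
  have : 2 * K / ‖v‖ * ‖v‖ ^ 2 = 2 * (K * ‖v‖) := by field_simp
  linarith

end GaussianConcentration

/-! ### Rotation interpolation and the moment generating function of a Lipschitz function -/

section GaussianCovariance

open scoped RealInnerProductSpace

variable {p : ℕ}

theorem measurePreserving_rotation (θ : ℝ) :
    MeasurePreserving (ContinuousLinearMap.rotation (E := Vec p) θ)
      ((stdGaussian (Vec p)).prod (stdGaussian (Vec p)))
      ((stdGaussian (Vec p)).prod (stdGaussian (Vec p))) :=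
  ⟨(ContinuousLinearMap.rotation θ).continuous.measurable,
    IsGaussian.map_rotation_eq_self (by simp) θ⟩

theorem rotation_neg_rotation (θ : ℝ) (z : Vec p × Vec p) :
    ContinuousLinearMap.rotation (-θ) (ContinuousLinearMap.rotation θ z) = z := by
  have h := Real.sin_sq_add_cos_sq θ
  ext i
  · simp only [ContinuousLinearMap.rotation_apply, Real.cos_neg, Real.sin_neg, PiLp.add_apply,
      PiLp.smul_apply, smul_eq_mul]
    linear_combination (z.1 i) * h
  · simp only [ContinuousLinearMap.rotation_apply, Real.cos_neg, Real.sin_neg, PiLp.add_apply,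
      PiLp.smul_apply, smul_eq_mul]
    linear_combination (z.2 i) * h

theorem norm_rotation_fst_le (θ : ℝ) (z : Vec p × Vec p) :
    ‖(ContinuousLinearMap.rotation θ z).1‖ ≤ ‖z.1‖ + ‖z.2‖ := by
  rw [ContinuousLinearMap.rotation_apply]
  refine (norm_add_le _ _).trans ?_
  rw [norm_smul, norm_smul, Real.norm_eq_abs, Real.norm_eq_abs]
  have h1 := Real.abs_cos_le_one θ
  have h2 := Real.abs_sin_le_one θ
  nlinarith [norm_nonneg z.1, norm_nonneg z.2]

theorem norm_rotation_fst_sub_le (θ τ : ℝ) (z : Vec p × Vec p) :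
    ‖(ContinuousLinearMap.rotation θ z).1 - (ContinuousLinearMap.rotation τ z).1‖
      ≤ (‖z.1‖ + ‖z.2‖) * |θ - τ| := by
  simp only [ContinuousLinearMap.rotation_apply]
  rw [add_sub_add_comm, ← sub_smul, ← sub_smul, add_mul]
  refine (norm_add_le _ _).trans ?_
  rw [norm_smul, norm_smul, Real.norm_eq_abs, Real.norm_eq_abs, mul_comm, mul_comm _ ‖z.2‖]
  exact add_le_add
    (mul_le_mul_of_nonneg_left (Real.abs_cos_sub_cos_le θ τ) (norm_nonneg _))
    (mul_le_mul_of_nonneg_left (Real.abs_sin_sub_sin_le θ τ) (norm_nonneg _))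

theorem hasDerivAt_rotation_fst (θ : ℝ) (z : Vec p × Vec p) :
    HasDerivAt (fun τ => (ContinuousLinearMap.rotation τ z).1)
      (ContinuousLinearMap.rotation θ z).2 θ := by
  simp only [ContinuousLinearMap.rotation_apply]
  exact ((Real.hasDerivAt_cos θ).smul_const z.1).add ((Real.hasDerivAt_sin θ).smul_const z.2)

variable {f : Vec p → ℝ}

theorem norm_gradient_le_of_lipschitzWith (hf : LipschitzWith 1 f) (x : Vec p) :
    ‖gradient f x‖ ≤ 1 := by
  rw [gradient, LinearIsometryEquiv.norm_map]
  exact_mod_cast norm_fderiv_le_of_lipschitz ℝ hf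

theorem measurable_gradient : Measurable (gradient f) :=
  (InnerProductSpace.toDual ℝ (Vec p)).symm.continuous.measurable.comp (measurable_fderiv ℝ f)

/-- The derivative along the rotation, at the angle `θ`. -/
theorem hasDerivAt_integral_mul_exp_rotation (hf : LipschitzWith 1 f) (s θ : ℝ) :
    HasDerivAt (fun τ => ∫ z, f z.1 * Real.exp (s * f (ContinuousLinearMap.rotation τ z).1)
        ∂((stdGaussian (Vec p)).prod (stdGaussian (Vec p))))
      (∫ z, f z.1 * (Real.exp (s * f (ContinuousLinearMap.rotation θ z).1) *
          (s * ⟪gradient f (ContinuousLinearMap.rotation θ z).1,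
            (ContinuousLinearMap.rotation θ z).2⟫))
        ∂((stdGaussian (Vec p)).prod (stdGaussian (Vec p)))) θ := by
  have hfc := hf.continuous
  have hrc : ∀ τ, Continuous (ContinuousLinearMap.rotation (E := Vec p) τ) :=
    fun τ => ContinuousLinearMap.continuous _
  have hfl : ∀ x, |f x| ≤ |f 0| + ‖x‖ := by simpa using abs_le_of_lipschitzWith hf
  have hb : ∀ τ (z : Vec p × Vec p), s * f (ContinuousLinearMap.rotation τ z).1
      ≤ |s| * (|f 0| + (‖z.1‖ + ‖z.2‖)) := fun τ z => by
    calc _ ≤ |s| * |f (ContinuousLinearMap.rotation τ z).1| := by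
          rw [← abs_mul]; exact le_abs_self _
      _ ≤ _ := by
        gcongr
        exact (hfl _).trans (by gcongr; exact norm_rotation_fst_le τ z)
  have hexp : ∀ a b : ℝ, 0 ≤ b → a ≤ b → a ≤ Real.exp b := fun a b _ h => by
    linarith [Real.add_one_le_exp b]
  -- The integrand is Lipschitz in the angle for every `z`, with an integrable constant, so
  -- differentiability at the single angle `θ` is needed only for almost every `z`; Rademacher's
  -- theorem supplies it.
  refine (hasDerivAt_integral_of_dominated_loc_of_lip (𝕜 := ℝ) (s := Set.univ)
    (bound := fun z => |f z.1| * (Real.exp (|s| * (|f 0| + (‖z.1‖ + ‖z.2‖))) *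
      (|s| * (‖z.1‖ + ‖z.2‖)))) Filter.univ_mem ?_ ?_ ?_ ?_ ?_ ?_).2
  · exact Filter.Eventually.of_forall fun τ => Continuous.aestronglyMeasurable (by fun_prop)
  · refine integrable_prod_of_le_exp_norm (Continuous.aestronglyMeasurable (by fun_prop))
      (Real.exp |f 0| * Real.exp (|s| * |f 0|)) (1 + |s|) fun z => ?_
    rw [abs_mul, abs_of_nonneg (Real.exp_nonneg _)]
    calc _ ≤ Real.exp (|f 0| + (‖z.1‖ + ‖z.2‖)) *
        Real.exp (|s| * (|f 0| + (‖z.1‖ + ‖z.2‖))) := by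
          gcongr ?_ * Real.exp ?_
          · exact hexp _ _ (by positivity) ((hfl _).trans (by linarith [norm_nonneg z.2]))
          · exact hb _ _
      _ = _ := by
        simp only [← Real.exp_add]
        congr 1
        ring
  · refine Measurable.aestronglyMeasurable ?_
    have h1 := (measurable_gradient (f := f)).comp ((hrc θ).measurable.fst)
    have h2 : Measurable fun z => ⟪gradient f (ContinuousLinearMap.rotation θ z).1,
        (ContinuousLinearMap.rotation θ z).2⟫ := h1.inner ((hrc θ).measurable.snd)
    have h3 : Measurable fun z : Vec p × Vec p => f z.1 := by fun_prop
    have h4 : Measurable fun z => Real.exp (s * f (ContinuousLinearMap.rotation θ z).1) := by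
      fun_prop
    exact h3.mul (h4.mul (h2.const_mul s))
  · refine ae_of_all _ fun z => LipschitzOnWith.of_dist_le_mul fun τ _ τ' _ => ?_
    rw [Real.coe_nnabs, abs_of_nonneg (by positivity), Real.dist_eq, ← mul_sub, abs_mul,
      Real.dist_eq, mul_assoc, mul_assoc]
    gcongr
    have hexpl : ∀ a b B : ℝ, a ≤ B → b ≤ B → |Real.exp a - Real.exp b| ≤ Real.exp B * |a - b| := by
      intro a b B
      wlog hab : b ≤ a generalizing a b with H
      · intro ha hb'
        rw [abs_sub_comm, abs_sub_comm a]
        exact H b a (le_of_not_ge hab) hb' ha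
      intro ha _
      rw [abs_of_nonneg (by linarith [Real.exp_le_exp.2 hab]), abs_of_nonneg (by linarith)]
      have h1 : Real.exp a - Real.exp b ≤ Real.exp a * (a - b) := by
        have h2 := Real.add_one_le_exp (b - a)
        have h3 : Real.exp b = Real.exp a * Real.exp (b - a) := by rw [← Real.exp_add]; ring_nf
        rw [h3]
        nlinarith [Real.exp_pos a]
      refine h1.trans ?_
      gcongr
    refine (hexpl _ _ _ (hb τ z) (hb τ' z)).trans (mul_le_mul_of_nonneg_left ?_ (Real.exp_nonneg _))
    rw [← mul_sub, abs_mul, mul_assoc]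
    refine mul_le_mul_of_nonneg_left ?_ (abs_nonneg s)
    have h5 := hf.dist_le_mul (ContinuousLinearMap.rotation τ z).1
      (ContinuousLinearMap.rotation τ' z).1
    rw [Real.dist_eq, dist_eq_norm, NNReal.coe_one, one_mul] at h5
    exact h5.trans (norm_rotation_fst_sub_le τ τ' z)
  · refine integrable_prod_of_le_exp_norm (Continuous.aestronglyMeasurable (by fun_prop))
      (Real.exp |f 0| * Real.exp (|s| * |f 0|)) (1 + |s| + |s|) fun z => ?_
    rw [abs_of_nonneg (by positivity)]
    calc _ ≤ Real.exp (|f 0| + (‖z.1‖ + ‖z.2‖)) *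
        (Real.exp (|s| * (|f 0| + (‖z.1‖ + ‖z.2‖))) * Real.exp (|s| * (‖z.1‖ + ‖z.2‖))) := by
          gcongr
          · exact hexp _ _ (by positivity) ((hfl _).trans (by linarith [norm_nonneg z.2]))
          · exact hexp _ _ (by positivity) le_rfl
      _ = _ := by
        simp only [← Real.exp_add]
        congr 1
        ring
  · have hae : ∀ᵐ x ∂(stdGaussian (Vec p)), DifferentiableAt ℝ f x :=
      (stdGaussian_absolutelyContinuous p).ae_le hf.ae_differentiableAt
    have hq := (Measure.quasiMeasurePreserving_fst
      (μ := stdGaussian (Vec p)) (ν := stdGaussian (Vec p))).comp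
      (measurePreserving_rotation θ).quasiMeasurePreserving
    filter_upwards [hq.ae hae] with z hz
    have h1 : HasDerivAt (fun τ => f (ContinuousLinearMap.rotation τ z).1)
        ⟪gradient f (ContinuousLinearMap.rotation θ z).1, (ContinuousLinearMap.rotation θ z).2⟫ θ := by
      rw [← InnerProductSpace.toDual_apply_apply, gradient, LinearIsometryEquiv.apply_symm_apply]
      exact (HasFDerivAt.comp_hasDerivAt_of_eq θ (DifferentiableAt.hasFDerivAt hz)
        (hasDerivAt_rotation_fst θ z) rfl)
    exact ((h1.const_mul s).exp).const_mul (f z.1)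

/-- Undoing the rotation by invariance of the product measure leaves the gradient and the
exponential depending on the first variable only. In the second variable the remaining factor is
`|sin θ|`-Lipschitz, so integration by parts applies for each fixed first variable. -/
theorem abs_integral_deriv_rotation_le (hf : LipschitzWith 1 f) (s θ : ℝ) :
    |∫ z, f z.1 * (Real.exp (s * f (ContinuousLinearMap.rotation θ z).1) *
          (s * ⟪gradient f (ContinuousLinearMap.rotation θ z).1,
            (ContinuousLinearMap.rotation θ z).2⟫))
        ∂((stdGaussian (Vec p)).prod (stdGaussian (Vec p)))|
      ≤ |s| * |Real.sin θ| * ∫ x, Real.exp (s * f x) ∂(stdGaussian (Vec p)) := by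
  set γ := stdGaussian (Vec p)
  set G : Vec p × Vec p → ℝ := fun z => f (ContinuousLinearMap.rotation (-θ) z).1 *
    (Real.exp (s * f z.1) * (s * ⟪gradient f z.1, z.2⟫)) with hG
  have hfc := hf.continuous
  have hrc : ∀ τ, Continuous (ContinuousLinearMap.rotation (E := Vec p) τ) :=
    fun τ => ContinuousLinearMap.continuous _
  have hGm : AEStronglyMeasurable G (γ.prod γ) := by
    refine Measurable.aestronglyMeasurable ?_
    have h2 : Measurable fun z : Vec p × Vec p => ⟪gradient f z.1, z.2⟫ :=
      (measurable_gradient.comp measurable_fst).inner measurable_snd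
    have h3 : Measurable fun z : Vec p × Vec p => f (ContinuousLinearMap.rotation (-θ) z).1 := by
      fun_prop
    have h4 : Measurable fun z : Vec p × Vec p => Real.exp (s * f z.1) := by
      fun_prop
    exact h3.mul (h4.mul (h2.const_mul s))
  have hfl : ∀ x, |f x| ≤ |f 0| + ‖x‖ := by simpa using abs_le_of_lipschitzWith hf
  have hexp : ∀ a b : ℝ, 0 ≤ b → a ≤ b → a ≤ Real.exp b := fun a b _ h => by
    linarith [Real.add_one_le_exp b]
  have hGi : Integrable G (γ.prod γ) := by
    refine integrable_prod_of_le_exp_norm hGm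
      (Real.exp |f 0| * Real.exp (|s| * |f 0|)) (1 + |s| + |s|) fun z => ?_
    rw [hG, abs_mul, abs_mul, Real.abs_exp, abs_mul]
    calc _ ≤ Real.exp (|f 0| + (‖z.1‖ + ‖z.2‖)) *
        (Real.exp (|s| * (|f 0| + (‖z.1‖ + ‖z.2‖))) * Real.exp (|s| * (‖z.1‖ + ‖z.2‖))) := by
          gcongr ?_ * (Real.exp ?_ * ?_)
          · exact hexp _ _ (by positivity) ((hfl _).trans
              (by linarith [norm_rotation_fst_le (-θ) z]))
          · refine (le_abs_self _).trans ?_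
            rw [abs_mul]
            refine mul_le_mul_of_nonneg_left ?_ (abs_nonneg s)
            exact (hfl _).trans (by linarith [norm_nonneg z.2])
          · refine hexp _ _ (by positivity) (mul_le_mul_of_nonneg_left ?_ (abs_nonneg s))
            refine (abs_real_inner_le_norm _ _).trans ?_
            nlinarith [norm_gradient_le_of_lipschitzWith hf z.1, norm_nonneg z.1, norm_nonneg z.2]
      _ = _ := by
        simp only [← Real.exp_add]
        congr 1
        ring
  have h1 : ∫ z, f z.1 * (Real.exp (s * f (ContinuousLinearMap.rotation θ z).1) *
          (s * ⟪gradient f (ContinuousLinearMap.rotation θ z).1,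
            (ContinuousLinearMap.rotation θ z).2⟫)) ∂(γ.prod γ) = ∫ z, G z ∂(γ.prod γ) := by
    have hmp := measurePreserving_rotation (p := p) θ
    have h2 := integral_map hmp.measurable.aemeasurable (f := G) (by rw [hmp.map_eq]; exact hGm)
    rw [hmp.map_eq] at h2
    rw [h2]
    simp only [hG, rotation_neg_rotation]
    rfl
  rw [h1, integral_prod G hGi, ← integral_const_mul, ← Real.norm_eq_abs]
  refine norm_integral_le_of_norm_le ((integrable_exp_mul_of_lipschitzWith hf s).const_mul _)
    (ae_of_all _ fun x => ?_)
  have hk : LipschitzWith ‖Real.sin θ‖₊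
      (fun y => f (ContinuousLinearMap.rotation (-θ) (x, y)).1) := by
    refine LipschitzWith.of_dist_le_mul fun y y' => ?_
    refine (hf.dist_le_mul _ _).trans ?_
    simp only [ContinuousLinearMap.rotation_apply]
    rw [NNReal.coe_one, one_mul, dist_add_left, Real.sin_neg, dist_smul₀, norm_neg, coe_nnnorm]
  have h2 := abs_integral_inner_mul_le hk (gradient f x)
  have h3 : ∫ y, G (x, y) ∂γ = (Real.exp (s * f x) * s) *
      ∫ y, ⟪gradient f x, y⟫ * f (ContinuousLinearMap.rotation (-θ) (x, y)).1 ∂γ := by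
    rw [← integral_const_mul]
    congr 1
    ext y
    simp only [hG]
    ring
  rw [h3, Real.norm_eq_abs, abs_mul, abs_mul, abs_of_nonneg (Real.exp_nonneg _)]
  calc _ ≤ Real.exp (s * f x) * |s| * (|Real.sin θ| * 1) := by
        gcongr
        refine h2.trans ?_
        rw [coe_nnnorm, Real.norm_eq_abs]
        gcongr
        exact norm_gradient_le_of_lipschitzWith hf x
    _ = _ := by ring

/-- The covariance of a Lipschitz function and its exponential under the Gaussian measure. -/
theorem integral_mul_exp_le (hf : LipschitzWith 1 f) {s : ℝ} (hs : 0 ≤ s) :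
    ∫ x, f x * Real.exp (s * f x) ∂(stdGaussian (Vec p))
      ≤ (∫ x, f x ∂(stdGaussian (Vec p)) + s) * ∫ x, Real.exp (s * f x) ∂(stdGaussian (Vec p)) := by
  set γ := stdGaussian (Vec p)
  set M := ∫ x, Real.exp (s * f x) ∂γ with hM
  have hM0 : 0 ≤ M := integral_nonneg fun x => Real.exp_nonneg _
  set φ : ℝ → ℝ := fun τ => ∫ z, f z.1 * Real.exp (s * f (ContinuousLinearMap.rotation τ z).1)
        ∂(γ.prod γ) with hφ
  have hd : ∀ θ, HasDerivAt (fun τ => φ τ - s * M * Real.cos τ) _ θ := fun θ =>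
    (hasDerivAt_integral_mul_exp_rotation hf s θ).sub ((Real.hasDerivAt_cos θ).const_mul (s * M))
  -- The derivative of `φ` is at least `-s M sin`, which the cosine term compensates. The endpoints
  -- are `φ 0 = ∫ f exp (s f)` and, by independence, `φ (π/2) = (∫ f) M`.
  have hmono : MonotoneOn (fun τ => φ τ - s * M * Real.cos τ) (Set.Icc 0 (Real.pi / 2)) := by
    refine monotoneOn_of_deriv_nonneg (convex_Icc _ _)
      (fun θ _ => (hd θ).continuousAt.continuousWithinAt)
      (fun θ _ => (hd θ).differentiableAt.differentiableWithinAt) fun θ hθ => ?_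
    rw [interior_Icc] at hθ
    have hsin : 0 ≤ Real.sin θ :=
      Real.sin_nonneg_of_nonneg_of_le_pi hθ.1.le (by linarith [hθ.2, Real.pi_pos])
    rw [(hd θ).deriv]
    have := (abs_le.1 (abs_integral_deriv_rotation_le hf s θ)).1
    rw [abs_of_nonneg hsin, abs_of_nonneg hs] at this
    linarith
  have h := hmono (Set.left_mem_Icc.2 (by positivity)) (Set.right_mem_Icc.2 (by positivity))
    (by positivity)
  simp only [Real.cos_zero, Real.cos_pi_div_two, hφ, ContinuousLinearMap.rotation_apply,
    Real.sin_zero, Real.sin_pi_div_two, one_smul, zero_smul, add_zero, zero_add] at h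
  rw [integral_prod_mul (μ := γ) (ν := γ) f (fun y => Real.exp (s * f y)),
    integral_fun_fst (μ := γ) (ν := γ) (fun x => f x * Real.exp (s * f x))] at h
  simp only [probReal_univ, one_smul] at h
  linarith

/-- The covariance bound reads `M' ≤ (m + t) M` for the moment generating function `M`. Multiplying
by the integrating factor gives a nonincreasing function with value `1` at `0`. -/
theorem mgf_le_exp_of_lipschitzWith (hf : LipschitzWith 1 f) {s : ℝ} (hs : 0 ≤ s) :
    mgf f (stdGaussian (Vec p)) s
      ≤ Real.exp (s * ∫ x, f x ∂(stdGaussian (Vec p)) + s ^ 2 / 2) := by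
  set m := ∫ x, f x ∂(stdGaussian (Vec p)) with hm
  have hset : integrableExpSet f (stdGaussian (Vec p)) = Set.univ :=
    Set.eq_univ_of_forall fun t => integrable_exp_mul_of_lipschitzWith hf t
  have hd : ∀ t, HasDerivAt (fun t => mgf f (stdGaussian (Vec p)) t *
      Real.exp (-(t * m + t ^ 2 / 2))) _ t := fun t =>
    (hasDerivAt_mgf (t := t) (by simp [hset])).mul
      ((((hasDerivAt_id t).mul_const m).add ((hasDerivAt_pow 2 t).div_const 2)).neg.exp)
  have hanti : AntitoneOn (fun t => mgf f (stdGaussian (Vec p)) t *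
      Real.exp (-(t * m + t ^ 2 / 2))) (Set.Ici 0) := by
    refine antitoneOn_of_deriv_nonpos (convex_Ici _)
      (fun θ _ => (hd θ).continuousAt.continuousWithinAt)
      (fun θ _ => (hd θ).differentiableAt.differentiableWithinAt) fun t ht => ?_
    rw [interior_Ici] at ht
    rw [(hd t).deriv]
    have h1 := integral_mul_exp_le hf (le_of_lt ht)
    have h2 : ∫ x, Real.exp (t * f x) ∂(stdGaussian (Vec p)) = mgf f (stdGaussian (Vec p)) t := rfl
    rw [h2, ← hm] at h1
    have h3 := Real.exp_pos (-(t * m + t ^ 2 / 2))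
    simp only [Pi.add_apply, Pi.neg_apply, id]
    have h4 : ∀ I M E : ℝ, I * E + M * (E * -(1 * m + ((2 : ℕ) : ℝ) * t ^ (2 - 1) / 2))
        = (I - (m + t) * M) * E := fun I M E => by
      push_cast
      ring
    rw [h4]
    exact mul_nonpos_of_nonpos_of_nonneg (by linarith) h3.le
  have h := hanti (Set.mem_Ici.2 le_rfl) (Set.mem_Ici.2 hs) hs
  simp only [mgf_zero, Real.exp_neg] at h
  norm_num at h
  rwa [← div_eq_mul_inv, div_le_one (Real.exp_pos _)] at h

/-- **Gaussian concentration**: a `1`-Lipschitz function of a standard Gaussian vector is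
sub-Gaussian with variance proxy `1`. -/
theorem hasSubgaussianMGF_of_lipschitzWith (hf : LipschitzWith 1 f) :
    HasSubgaussianMGF (fun x => f x - ∫ y, f y ∂(stdGaussian (Vec p))) 1
      (stdGaussian (Vec p)) := by
  set m := ∫ x, f x ∂(stdGaussian (Vec p)) with hm
  have hexp : ∀ t, ∀ x, Real.exp (t * (f x - m)) = Real.exp (-(t * m)) * Real.exp (t * f x) := by
    intro t x
    rw [← Real.exp_add]
    ring_nf
  refine ⟨fun t => ?_, fun t => ?_⟩
  · simp only [hexp]
    exact (integrable_exp_mul_of_lipschitzWith hf t).const_mul _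
  · have h0 : mgf (fun x => f x - m) (stdGaussian (Vec p)) t
        = Real.exp (-(t * m)) * mgf f (stdGaussian (Vec p)) t := by
      simp only [mgf, hexp, integral_const_mul]
    have h1 : mgf f (stdGaussian (Vec p)) t ≤ Real.exp (t * m + t ^ 2 / 2) := by
      rcases le_total 0 t with ht | ht
      · exact mgf_le_exp_of_lipschitzWith hf ht
      · have hf' : LipschitzWith 1 (fun x => -f x) := by
          have := hf.neg
          exact this
        have := mgf_le_exp_of_lipschitzWith hf' (s := -t) (by linarith)
        rw [integral_neg] at this
        simpa [mgf, hm] using this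
    rw [h0]
    calc _ ≤ Real.exp (-(t * m)) * Real.exp (t * m + t ^ 2 / 2) := by gcongr
      _ = _ := by
        rw [← Real.exp_add]
        simp

end GaussianCovariance

/-! ### The proximal denoiser and the subdifferential of the gauge -/

section Denoising

open scoped RealInnerProductSpace Pointwise

variable {p : ℕ} {C : Set (Vec p)}

theorem gauge_add_le_of_interior (hC : Convex ℝ C) (h0 : (0 : Vec p) ∈ interior C) (x y : Vec p) :
    gauge C (x + y) ≤ gauge C x + gauge C y :=
  gauge_add_le hC (absorbent_nhds_zero (mem_interior_iff_mem_nhds.1 h0)) x y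

theorem gauge_smul_nonneg {a : ℝ} (ha : 0 ≤ a) (x : Vec p) :
    gauge C (a • x) = a * gauge C x := by
  rw [gauge_smul_of_nonneg ha, smul_eq_mul]

theorem inner_le_gauge_of_mem_subdiff (hC : Convex ℝ C) (h0 : (0 : Vec p) ∈ interior C)
    {x w : Vec p} (hw : w ∈ subdiff (gauge C) x) (z : Vec p) : ⟪w, z⟫ ≤ gauge C z := by
  have h1 := hw (x + z)
  rw [add_sub_cancel_left] at h1
  linarith [gauge_add_le_of_interior hC h0 x z]

/-- Hahn–Banach extends `c • x ↦ c * gauge C x` from the line through `x` to a functional dominated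
by the gauge. Nonemptiness matters because `Metric.infDist` to the empty set is `0`. -/
theorem subdiff_gauge_nonempty (hC : Convex ℝ C) (h0 : (0 : Vec p) ∈ interior C) (x : Vec p) :
    (subdiff (gauge C) x).Nonempty := by
  rcases eq_or_ne x 0 with rfl | hx
  · refine ⟨0, fun z => ?_⟩
    simpa using gauge_nonneg z
  obtain ⟨g, hg, hgle⟩ := exists_extension_of_le_sublinear
    (LinearPMap.mkSpanSingleton x (gauge C x) hx) (gauge C)
    (fun c hc y => gauge_smul_nonneg hc.le y) (gauge_add_le_of_interior hC h0) (by
      rintro ⟨y, hy⟩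
      obtain ⟨c, rfl⟩ := Submodule.mem_span_singleton.1 hy
      have h1 : LinearPMap.mkSpanSingleton x (gauge C x) hx ⟨c • x, hy⟩ = c • gauge C x :=
        LinearPMap.mkSpanSingleton'_apply x (gauge C x) _ c hy
      rw [h1, smul_eq_mul]
      rcases le_total 0 c with hc | hc
      · rw [gauge_smul_nonneg hc]
      · exact (mul_nonpos_of_nonpos_of_nonneg hc (gauge_nonneg x)).trans (gauge_nonneg _))
  have hgx : g x = gauge C x := by
    have h := hg ⟨x, Submodule.mem_span_singleton_self x⟩
    exact h.trans (LinearPMap.mkSpanSingleton'_apply_self x (gauge C x) _ _)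
  refine ⟨(InnerProductSpace.toDual ℝ (Vec p)).symm (LinearMap.toContinuousLinearMap g), fun z => ?_⟩
  rw [InnerProductSpace.toDual_symm_apply]
  simp only [LinearMap.coe_toContinuousLinearMap', map_sub, hgx]
  linarith [hgle z]

/-- First-order optimality: compare the minimizer with a point a fraction `s` of the way to `z`, use
convexity of the gauge, divide by `s` and let `s` tend to `0`. -/
theorem inner_sub_prox_le (hC : Convex ℝ C) (h0 : (0 : Vec p) ∈ interior C) {lam : ℝ}
    (hlam : 0 ≤ lam) (y z : Vec p) :
    ⟪y - prox C lam y, z - prox C lam y⟫ ≤ lam * (gauge C z - gauge C (prox C lam y)) := by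
  set x := prox C lam y with hx
  set A := ⟪y - x, z - x⟫ - lam * (gauge C z - gauge C x) with hA
  have key : ∀ s : ℝ, 0 < s → s ≤ 1 → A ≤ s * (‖z - x‖ ^ 2 / 2) := by
    intro s hs hs1
    have h1 := prox_spec hC h0 hlam y (x + s • (z - x))
    rw [← hx] at h1
    have h2 : gauge C (x + s • (z - x)) ≤ (1 - s) * gauge C x + s * gauge C z := by
      have h3 : x + s • (z - x) = (1 - s) • x + s • z := by
        rw [smul_sub, sub_smul, one_smul]
        abel
      rw [h3, ← gauge_smul_nonneg (by linarith : 0 ≤ 1 - s), ← gauge_smul_nonneg hs.le]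
      exact gauge_add_le_of_interior hC h0 _ _
    have h4 : ‖y - (x + s • (z - x))‖ ^ 2
        = ‖y - x‖ ^ 2 - 2 * (s * ⟪y - x, z - x⟫) + s ^ 2 * ‖z - x‖ ^ 2 := by
      rw [← sub_sub, norm_sub_sq_real, inner_smul_right, norm_smul, mul_pow, Real.norm_eq_abs,
        sq_abs]
    unfold proxObj at h1
    rw [h4] at h1
    have h5 := mul_le_mul_of_nonneg_left h2 hlam
    have h6 : s * A ≤ s * (s * (‖z - x‖ ^ 2 / 2)) := by
      rw [hA]
      nlinarith
    exact le_of_mul_le_mul_left h6 hs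
  have hA0 : A ≤ 0 := by
    refine le_of_forall_pos_le_add fun e he => ?_
    set B := ‖z - x‖ ^ 2 / 2 with hB
    have hB0 : 0 ≤ B := by positivity
    have hpos : 0 < min 1 (e / (B + 1)) := lt_min one_pos (by positivity)
    refine (key _ hpos (min_le_left _ _)).trans ?_
    rw [zero_add]
    calc _ ≤ e / (B + 1) * (B + 1) := by
          gcongr
          · exact min_le_right _ _
          · linarith
      _ = e := by field_simp
  linarith

/-- The proximal denoiser is nonexpansive. -/
theorem norm_prox_sub_prox_le (hC : Convex ℝ C) (h0 : (0 : Vec p) ∈ interior C) {lam : ℝ}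
    (hlam : 0 ≤ lam) (y y' : Vec p) : ‖prox C lam y - prox C lam y'‖ ≤ ‖y - y'‖ := by
  have h1 := inner_sub_prox_le hC h0 hlam y (prox C lam y')
  have h2 := inner_sub_prox_le hC h0 hlam y' (prox C lam y)
  set x := prox C lam y
  set x' := prox C lam y'
  -- The gauge terms of the two optimality inequalities are opposite, so the last two inner products
  -- sum to at most `0`.
  have h3 : ‖x - x'‖ ^ 2 = ⟪y - y', x - x'⟫ + ⟪y - x, x' - x⟫ + ⟪y' - x', x - x'⟫ := by
    rw [← real_inner_self_eq_norm_sq, ← neg_sub x x', inner_neg_right]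
    simp only [inner_sub_left]
    ring
  have h4 : ‖x - x'‖ ^ 2 ≤ ‖y - y'‖ * ‖x - x'‖ := by
    linarith [real_inner_le_norm (y - y') (x - x')]
  rcases (norm_nonneg (x - x')).eq_or_lt with h | h
  · rw [← h]
    exact norm_nonneg _
  · rw [sq] at h4
    exact le_of_mul_le_mul_right h4 h

/-- The error of the proximal denoiser is at most the distance of the noise to the scaled
subdifferential. -/
theorem norm_prox_sub_le_infDist (hC : Convex ℝ C) (h0 : (0 : Vec p) ∈ interior C) {lam : ℝ}
    (hlam : 0 ≤ lam) (x e : Vec p) :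
    ‖prox C lam (x + e) - x‖ ≤ Metric.infDist e (lam • subdiff (gauge C) x) := by
  have hne : (lam • subdiff (gauge C) x).Nonempty := (subdiff_gauge_nonempty hC h0 x).smul_set
  refine (Metric.le_infDist hne).2 ?_
  rintro _ ⟨w, hw, rfl⟩
  have h1 := inner_sub_prox_le hC h0 hlam (x + e) x
  have h2 := mul_le_mul_of_nonneg_left (hw (prox C lam (x + e))) hlam
  set u := prox C lam (x + e)
  -- Optimality tested at `x` bounds the second term and the subgradient inequality tested at `u`
  -- the third; their gauge terms cancel.
  have h3 : ‖u - x‖ ^ 2 = ⟪e - lam • w, u - x⟫ + ⟪x + e - u, x - u⟫ + lam * ⟪w, u - x⟫ := by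
    rw [← real_inner_self_eq_norm_sq, ← neg_sub u x, inner_neg_right]
    simp only [inner_sub_left, inner_add_left, inner_smul_left, RCLike.conj_to_real]
    ring
  have h4 : ‖u - x‖ ^ 2 ≤ ‖e - lam • w‖ * ‖u - x‖ := by
    nlinarith [real_inner_le_norm (e - lam • w) (u - x)]
  simp only [dist_eq_norm]
  rcases (norm_nonneg (u - x)).eq_or_lt with h | h
  · rw [← h]
    exact norm_nonneg _
  · rw [sq] at h4
    exact le_of_mul_le_mul_right h4 h

theorem lipschitzWith_infDist_smul_subdiff (lam : ℝ) (x : Vec p) :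
    LipschitzWith 1 (fun g : Vec p => Metric.infDist g (lam • subdiff (gauge C) x)) :=
  Metric.lipschitz_infDist_pt _

theorem expDist_nonneg (x : Vec p) (lam : ℝ) : 0 ≤ expDist C x lam :=
  integral_nonneg fun _ => Metric.infDist_nonneg

/-- In positive dimension, a Gaussian vector is at a positive expected distance from the scaled
subdifferential. -/
theorem expDist_pos (hp : 0 < p) (hC : Convex ℝ C) (h0 : (0 : Vec p) ∈ interior C)
    (x : Vec p) {lam : ℝ} (hlam : 0 ≤ lam) : 0 < expDist C x lam := by
  refine (expDist_nonneg x lam).lt_of_ne' fun h => ?_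
  rw [expDist, multivariateGaussian_zero_one, integral_eq_zero_iff_of_nonneg
    (fun _ => Metric.infDist_nonneg)
    (integrable_of_lipschitzWith (lipschitzWith_infDist_smul_subdiff lam x))] at h
  let i : Fin p := ⟨0, hp⟩
  set u : Vec p := EuclideanSpace.single i (1 : ℝ) with hu
  -- If the distance vanishes almost surely, `g` lies within `1` of a scaled subgradient, whose
  -- `i`-th coordinate is at most `lam * gauge C u`. A Gaussian coordinate is not bounded above. The
  -- slack `1` avoids needing a nearest point.
  have hbd : ∀ᵐ g ∂(stdGaussian (Vec p)), g i < lam * gauge C u + 1 := by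
    filter_upwards [h] with g hg
    have hne : (lam • subdiff (gauge C) x).Nonempty := (subdiff_gauge_nonempty hC h0 x).smul_set
    obtain ⟨_, ⟨w, hw, rfl⟩, hd⟩ := (Metric.infDist_lt_iff hne).1
      (show Metric.infDist g (lam • subdiff (gauge C) x) < 1 by rw [hg]; exact one_pos)
    have h1 := mul_le_mul_of_nonneg_left (inner_le_gauge_of_mem_subdiff hC h0 hw u) hlam
    have h2 : ⟪w, u⟫ = w i := by rw [hu, EuclideanSpace.inner_single_right]; simp
    have h3 : |g i - lam * w i| < 1 := by
      refine lt_of_le_of_lt ?_ hd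
      rw [dist_eq_norm]
      simpa using PiLp.norm_apply_le (g - lam • w) i
    rw [h2] at h1
    linarith [(abs_lt.1 h3).2]
  have hmp := measurePreserving_eval_multivariateGaussian (μ := (0 : Vec p))
    (Matrix.PosSemidef.one (n := Fin p) (R := ℝ)) (i := i)
  rw [multivariateGaussian_zero_one] at hmp
  have h1 : gaussianReal 0 1 (Set.Ici (lam * gauge C u + 1)) = 0 := by
    have h2 := hmp.measure_preimage (s := Set.Ici (lam * gauge C u + 1))
      measurableSet_Ici.nullMeasurableSet
    simp only [PiLp.zero_apply, Matrix.one_apply_eq, Real.toNNReal_one] at h2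
    rw [← h2]
    refine measure_mono_null (fun g hg => ?_) hbd
    simpa using hg
  have h2 := gaussianReal_absolutelyContinuous' 0 one_ne_zero h1
  simp at h2

section GaussianDistance

variable {X : ℕ → Vec p} {n : ℕ}

theorem expDist_le_maxExpDist {t : ℕ} (ht : t ∈ Set.Icc 1 n) (lam : ℝ) :
    expDist C (X t) lam ≤ maxExpDist C X n lam :=
  le_csSup ((Set.finite_Icc 1 n).image _).bddAbove (Set.mem_image_of_mem _ ht)

theorem gaussianDistance_eq {lam₀ : ℝ} (hlam₀ : 0 ≤ lam₀)
    (hmin : IsMinOn (maxExpDist C X n) (Set.Ici 0) lam₀) :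
    gaussianDistance C X n = maxExpDist C X n lam₀ :=
  IsLeast.csInf_eq ⟨Set.mem_image_of_mem _ hlam₀, by
    rintro _ ⟨l, hl, rfl⟩
    exact hmin hl⟩

end GaussianDistance

end Denoising

/-! ### Distribution of the window means and the union bound -/

section Noise

open scoped RealInnerProductSpace Pointwise

variable {Ω : Type*} [MeasurableSpace Ω] {μ : Measure Ω} {p n : ℕ}

theorem sum_Ico_eq_sum_subtype {ε : ℕ → Vec p} {i j : ℕ} (hi : 1 ≤ i) (hj : j ≤ n + 1) :
    ∑ t ∈ (Finset.Ico i j).subtype (· ∈ Set.Icc 1 n), ε t = ∑ t ∈ Finset.Ico i j, ε t :=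
  Finset.sum_subtype_of_mem ε fun t ht => by
    have := Finset.mem_Ico.1 ht
    exact ⟨by omega, by omega⟩

theorem charFun_multivariateGaussian_smul_one (σ : ℝ) (x : Vec p) :
    charFun (multivariateGaussian (0 : Vec p) (σ ^ 2 • 1)) x
      = Complex.exp (-(σ ^ 2 * ‖x‖ ^ 2) / 2) := by
  rw [charFun_multivariateGaussian (Matrix.PosSemidef.one.smul (sq_nonneg σ))]
  have h : (x.ofLp ⬝ᵥ (σ ^ 2 • (1 : Matrix (Fin p) (Fin p) ℝ)).mulVec x.ofLp : ℝ)
      = σ ^ 2 * ‖x‖ ^ 2 := by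
    rw [Matrix.smul_mulVec, Matrix.one_mulVec, dotProduct_smul, smul_eq_mul,
      EuclideanSpace.real_norm_sq_eq]
    simp [dotProduct, sq]
  rw [h]
  simp only [inner_zero_right, Complex.ofReal_zero, zero_mul, zero_sub, neg_div]
  push_cast
  rfl

/-- The rescaled mean of the noise over a window is standard Gaussian. -/
theorem hasLaw_smul_windowMean {σ : ℝ} (hσ : 0 < σ) {ε : ℕ → Ω → Vec p}
    [IsProbabilityMeasure μ]
    (hlaw : ∀ t ∈ Set.Icc 1 n, HasLaw (ε t) (multivariateGaussian 0 (σ ^ 2 • 1)) μ)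
    (hindep : iIndepFun (fun t : Set.Icc 1 n => ε t) μ) {θ i : ℕ} (hθ : 1 ≤ θ) (hi : 1 ≤ i)
    (hin : i + θ ≤ n + 1) :
    HasLaw (fun ω => (√θ / σ) • windowMean θ (fun t => ε t ω) i) (stdGaussian (Vec p)) μ := by
  set S : Finset (Set.Icc 1 n) := (Finset.Ico i (i + θ)).subtype (· ∈ Set.Icc 1 n) with hS
  have hmS : ∀ t : Set.Icc 1 n, AEMeasurable (ε t) μ := fun t => (hlaw t t.2).aemeasurable
  have hθ0 : (0 : ℝ) < θ := by exact_mod_cast hθ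
  have hsum : ∀ ω, (√θ / σ) • windowMean θ (fun t => ε t ω) i
      = (√θ / σ * (θ : ℝ)⁻¹) • ∑ t ∈ S, ε t ω := fun ω => by
    rw [windowMean, smul_smul, hS, sum_Ico_eq_sum_subtype (ε := fun t => ε t ω) hi hin]
  have hcard : S.card = θ := by
    rw [hS, Finset.card_subtype, Finset.filter_true_of_mem, Nat.card_Ico, Nat.add_sub_cancel_left]
    intro t ht
    have := Finset.mem_Ico.1 ht
    exact ⟨by omega, by omega⟩
  have hms : AEMeasurable (fun ω => ∑ t ∈ S, ε t ω) μ :=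
    Finset.aemeasurable_fun_sum S fun t _ => hmS t
  simp only [hsum]
  refine ⟨by fun_prop, ?_⟩
  have hmap : μ.map (fun ω => (√θ / σ * (θ : ℝ)⁻¹) • ∑ t ∈ S, ε t ω)
      = (μ.map (fun ω => ∑ t ∈ S, ε t ω)).map (fun x => (√θ / σ * (θ : ℝ)⁻¹) • x) := by
    rw [AEMeasurable.map_map_of_aemeasurable (by fun_prop) hms]
    rfl
  rw [hmap]
  have := Measure.isProbabilityMeasure_map hms
  have := Measure.isProbabilityMeasure_map (μ := μ.map (fun ω => ∑ t ∈ S, ε t ω))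
    (f := fun x : Vec p => (√θ / σ * (θ : ℝ)⁻¹) • x) (by fun_prop)
  refine Measure.ext_of_charFun ?_
  ext x
  rw [charFun_map_smul, iIndepFun.charFun_map_fun_finsetSum_eq_prod (fun t _ => hmS t)
    (hindep.restrict S), Finset.prod_apply]
  simp only [fun t : Set.Icc 1 n => (hlaw t t.2).map_eq, charFun_multivariateGaussian_smul_one,
    Finset.prod_const, hcard, charFun_stdGaussian, ← Complex.exp_nat_mul]
  congr 1
  -- The scaling is chosen so that the `θ` summands, each of variance `σ²` per coordinate, have
  -- total variance `1`.
  have h1 : (θ : ℝ) * (σ ^ 2 * ‖(√θ / σ * (θ : ℝ)⁻¹) • x‖ ^ 2) = ‖x‖ ^ 2 := by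
    rw [norm_smul, Real.norm_of_nonneg (by positivity), mul_pow, mul_pow, div_pow,
      Real.sq_sqrt hθ0.le]
    field_simp
  rw [← mul_div_assoc, mul_neg]
  congr 2
  exact_mod_cast h1

theorem indepFun_smul_windowMean {ε : ℕ → Ω → Vec p} (c : ℝ)
    (hm : ∀ t ∈ Set.Icc 1 n, AEMeasurable (ε t) μ)
    (hindep : iIndepFun (fun t : Set.Icc 1 n => ε t) μ) {θ i j : ℕ} (hi : 1 ≤ i)
    (hij : i + θ ≤ j) (hjn : j + θ ≤ n + 1) :
    IndepFun (fun ω => c • windowMean θ (fun t => ε t ω) j)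
      (fun ω => c • windowMean θ (fun t => ε t ω) i) μ := by
  set S : ℕ → Finset (Set.Icc 1 n) := fun i => (Finset.Ico i (i + θ)).subtype (· ∈ Set.Icc 1 n)
    with hS
  have hdisj : Disjoint (S j) (S i) := by
    rw [Finset.disjoint_left]
    intro t h1 h2
    simp only [hS, Finset.mem_subtype, Finset.mem_Ico] at h1 h2
    omega
  have h := (hindep.indepFun_finset₀ (S j) (S i) hdisj fun t => hm t t.2).comp
    (φ := fun v => c • (θ : ℝ)⁻¹ • ∑ t, v t) (ψ := fun v => c • (θ : ℝ)⁻¹ • ∑ t, v t)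
    (by fun_prop) (by fun_prop)
  convert h using 2 with ω ω
  · rw [Function.comp_apply, windowMean, ← sum_Ico_eq_sum_subtype (n := n) (by omega) (by omega),
      ← Finset.sum_coe_sort]
  · rw [Function.comp_apply, windowMean, ← sum_Ico_eq_sum_subtype (n := n) (by omega) (by omega),
      ← Finset.sum_coe_sort]

/-- Tail bound for the sum of two `1`-Lipschitz functions of independent standard Gaussian
vectors. -/
theorem measureReal_integral_add_le_of_indepFun [IsProbabilityMeasure μ] {U V : Ω → Vec p}
    (hU : HasLaw U (stdGaussian (Vec p)) μ) (hV : HasLaw V (stdGaussian (Vec p)) μ)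
    (hUV : IndepFun U V μ) {f g : Vec p → ℝ} (hf : LipschitzWith 1 f) (hg : LipschitzWith 1 g)
    {x : ℝ} (hx : 0 ≤ x) :
    μ.real {ω | ∫ y, f y ∂(stdGaussian (Vec p)) + ∫ y, g y ∂(stdGaussian (Vec p)) + x
      ≤ f (U ω) + g (V ω)} ≤ Real.exp (-x ^ 2 / 4) := by
  set a := ∫ y, f y ∂(stdGaussian (Vec p)) with ha
  set b := ∫ y, g y ∂(stdGaussian (Vec p)) with hb
  have h1 : HasSubgaussianMGF ((fun y => f y - a) ∘ U) 1 μ :=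
    HasSubgaussianMGF.of_map hU.aemeasurable
      (by rw [hU.map_eq]; exact hasSubgaussianMGF_of_lipschitzWith hf)
  have h2 : HasSubgaussianMGF ((fun y => g y - b) ∘ V) 1 μ :=
    HasSubgaussianMGF.of_map hV.aemeasurable
      (by rw [hV.map_eq]; exact hasSubgaussianMGF_of_lipschitzWith hg)
  have hfc := hf.continuous
  have hgc := hg.continuous
  have h3 := (h1.add_of_indepFun h2
    (hUV.comp (φ := fun y => f y - a) (ψ := fun y => g y - b) (by fun_prop)
      (by fun_prop))).measure_ge_le hx
  -- Independence adds the variance proxies to `2`, better than the `4` available for dependent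
  -- summands.
  have h4 : -x ^ 2 / (2 * ((1 + 1 : NNReal) : ℝ)) = -x ^ 2 / 4 := by norm_num
  rw [h4] at h3
  refine le_trans (le_of_eq ?_) h3
  congr 1
  ext ω
  simp only [Set.mem_ofPred_eq, Function.comp_apply]
  constructor <;> intro h <;> linarith

variable {C : Set (Vec p)}

/-- The sum of the denoising errors of the two windows at `t` is at most its expected bound plus a
deviation. -/
def smallNoise (C : Set (Vec p)) (X e : ℕ → Vec p) (θ : ℕ) (lam b : ℝ) (t : ℕ) : Prop :=
  Metric.infDist (windowMean θ e (t + 1)) (lam • subdiff (gauge C) (X (t + 1)))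
    + Metric.infDist (windowMean θ e (t + 1 - θ)) (lam • subdiff (gauge C) (X t)) < b

/-- After division by `σ/√θ` the noise is standard Gaussian and the multiplier is `lam₀`, where each
expected distance is at most `η` because `lam₀` is a minimizer. -/
theorem measureReal_not_smallNoise_le [IsProbabilityMeasure μ] {σ : ℝ} (hσ : 0 < σ)
    {X : ℕ → Vec p} {ε : ℕ → Ω → Vec p}
    (hlaw : ∀ t ∈ Set.Icc 1 n, HasLaw (ε t) (multivariateGaussian 0 (σ ^ 2 • 1)) μ)
    (hindep : iIndepFun (fun t : Set.Icc 1 n => ε t) μ) {θ : ℕ} (hθ : 1 ≤ θ)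
    {lam₀ : ℝ} (hlam₀ : 0 ≤ lam₀) (hmin : IsMinOn (maxExpDist C X n) (Set.Ici 0) lam₀)
    {x : ℝ} (hx : 0 ≤ x) {t : ℕ} (h1 : θ ≤ t) (h2 : t + θ ≤ n) :
    μ.real {ω | ¬ smallNoise C X (fun t => ε t ω) θ (σ / √θ * lam₀)
      (σ / √θ * (2 * gaussianDistance C X n + x)) t} ≤ Real.exp (-x ^ 2 / 4) := by
  have hθ0 : (0 : ℝ) < θ := by exact_mod_cast hθ
  have hc : 0 < σ / √θ := by positivity
  have hU := hasLaw_smul_windowMean hσ hlaw hindep (i := t + 1) hθ (by omega) (by omega)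
  have hV := hasLaw_smul_windowMean hσ hlaw hindep (i := t + 1 - θ) hθ (by omega) (by omega)
  have hUV := indepFun_smul_windowMean (√θ / σ) (fun t ht => (hlaw t ht).aemeasurable) hindep
    (θ := θ) (i := t + 1 - θ) (j := t + 1) (by omega) (by omega) (by omega)
  refine le_trans (measureReal_mono (fun ω hω => ?_)) (measureReal_integral_add_le_of_indepFun
    hU hV hUV (lipschitzWith_infDist_smul_subdiff (C := C) lam₀ (X (t + 1)))
    (lipschitzWith_infDist_smul_subdiff (C := C) lam₀ (X t)) hx)
  have hscale : ∀ (w z : Vec p), Metric.infDist w ((σ / √θ * lam₀) • subdiff (gauge C) z)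
      = σ / √θ * Metric.infDist ((√θ / σ) • w) (lam₀ • subdiff (gauge C) z) := by
    intro w z
    have h3 : w = (σ / √θ) • (√θ / σ) • w := by
      rw [smul_smul, show σ / √θ * (√θ / σ) = 1 by field_simp, one_smul]
    conv_lhs => rw [h3]
    rw [mul_smul, infDist_smul₀ hc.ne', Real.norm_of_nonneg hc.le]
  simp only [smallNoise, Set.mem_ofPred_eq, not_lt, hscale, ← mul_add] at hω ⊢
  have h3 := le_of_mul_le_mul_left hω hc
  have h4 := expDist_le_maxExpDist (C := C) (X := X) (n := n) (t := t) ⟨by omega, by omega⟩ lam₀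
  have h5 := expDist_le_maxExpDist (C := C) (X := X) (n := n) (t := t + 1) ⟨by omega, by omega⟩ lam₀
  rw [← gaussianDistance_eq hlam₀ hmin, expDist, multivariateGaussian_zero_one] at h4 h5
  linarith

/-- With probability at least `1 - n ^ (1 - r ^ 2)`, the noise is small at all indices. -/
theorem le_measureReal_forall_smallNoise [IsProbabilityMeasure μ] (hn : 1 ≤ n) {σ : ℝ} (hσ : 0 < σ)
    {X : ℕ → Vec p} {ε : ℕ → Ω → Vec p}
    (hlaw : ∀ t ∈ Set.Icc 1 n, HasLaw (ε t) (multivariateGaussian 0 (σ ^ 2 • 1)) μ)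
    (hindep : iIndepFun (fun t : Set.Icc 1 n => ε t) μ) {θ : ℕ} (hθ : 1 ≤ θ)
    {lam₀ : ℝ} (hlam₀ : 0 ≤ lam₀) (hmin : IsMinOn (maxExpDist C X n) (Set.Ici 0) lam₀)
    {r : ℝ} (hr : 0 ≤ r) :
    1 - (n : ℝ) ^ (1 - r ^ 2) ≤ μ.real {ω | ∀ t, θ ≤ t → t + θ ≤ n →
      smallNoise C X (fun t => ε t ω) θ (σ / √θ * lam₀)
        (σ / √θ * (2 * gaussianDistance C X n + 2 * r * √(Real.log n))) t} := by
  set E : ℕ → Set Ω := fun t => {ω | ¬ smallNoise C X (fun t => ε t ω) θ (σ / √θ * lam₀)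
        (σ / √θ * (2 * gaussianDistance C X n + 2 * r * √(Real.log n))) t} with hE
  have hn0 : (0 : ℝ) < n := by exact_mod_cast hn
  have hlog : 0 ≤ Real.log n := Real.log_nonneg (by exact_mod_cast hn)
  have h1 : μ.real (⋃ t ∈ Finset.Icc θ (n - θ), E t) ≤ (n : ℝ) ^ (1 - r ^ 2) := by
    refine (measureReal_biUnion_finset_le _ _).trans ?_
    calc ∑ t ∈ Finset.Icc θ (n - θ), μ.real (E t)
        ≤ ∑ t ∈ Finset.Icc θ (n - θ), (n : ℝ) ^ (-r ^ 2) := by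
          refine Finset.sum_le_sum fun t ht => ?_
          rw [Finset.mem_Icc] at ht
          refine (measureReal_not_smallNoise_le hσ hlaw hindep hθ hlam₀ hmin
            (by positivity) ht.1 (by omega)).trans (le_of_eq ?_)
          -- The deviation `2r√(log n)` turns `exp (-x²/4)` into exactly `n ^ (-r²)`.
          rw [Real.rpow_def_of_pos hn0, mul_pow, Real.sq_sqrt hlog]
          ring_nf
      _ ≤ n * (n : ℝ) ^ (-r ^ 2) := by
          rw [Finset.sum_const, nsmul_eq_mul]
          gcongr
          rw [Nat.card_Icc]
          omega
      _ = _ := by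
          rw [sub_eq_add_neg, Real.rpow_add hn0, Real.rpow_one]
  set G : Set Ω := {ω | ∀ t, θ ≤ t → t + θ ≤ n →
      smallNoise C X (fun t => ε t ω) θ (σ / √θ * lam₀)
        (σ / √θ * (2 * gaussianDistance C X n + 2 * r * √(Real.log n))) t} with hG
  have h2 : G ∪ (⋃ t ∈ Finset.Icc θ (n - θ), E t) = Set.univ := by
    refine Set.eq_univ_of_forall fun ω => ?_
    by_cases hω : ω ∈ G
    · exact Or.inl hω
    · right
      simp only [hG, Set.mem_ofPred_eq, not_forall] at hω
      obtain ⟨t, ht1, ht2, ht3⟩ := hω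
      exact Set.mem_biUnion (x := t) (by simp; omega) ht3
  have h3 := measureReal_union_le (μ := μ) G (⋃ t ∈ Finset.Icc θ (n - θ), E t)
  rw [h2, probReal_univ] at h3
  linarith

end Noise

/-! ### Combinatorics of the groups -/

section Selection

/-- The groups of the nonzero entries, if these cluster around well separated points. -/
theorem groupOf_eq_filter {D cp : Finset ℕ} {θ : ℕ} (hcpD : cp ⊆ D)
    (hnear : ∀ t ∈ D, ∃ s ∈ cp, t < s + θ ∧ s < t + θ)
    (hsep : ∀ s ∈ cp, ∀ t ∈ cp, s < t → s + 4 * θ ≤ t) {s t : ℕ} (hs : s ∈ cp) (ht : t ∈ D)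
    (hst : t < s + θ ∧ s < t + θ) :
    groupOf D θ t = D.filter fun u => u < s + θ ∧ s < u + θ := by
  classical
  ext u
  simp only [groupOf, Finset.mem_filter]
  refine ⟨fun ⟨hu, h⟩ => ⟨hu, ?_⟩, fun ⟨hu, h⟩ => ⟨hu, ?_⟩⟩
  · clear hu
    induction h with
    | refl => exact hst
    | @tail a b hta hab ih =>
      have ha := ih ⟨hab.1, hta⟩
      -- A step of length at most `θ` between points less than `θ` from `s` and `s'` would put these
      -- within `3θ`, so separation forces `s = s'`.
      obtain ⟨s', hs', hb⟩ := hnear b hab.2.1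
      rcases lt_trichotomy s s' with h | rfl | h
      · have := hsep s hs s' hs' h
        omega
      · exact hb
      · have := hsep s' hs' s hs h
        omega
  · exact (Relation.ReflTransGen.single ⟨ht, hcpD hs, by omega, by omega⟩).tail
      ⟨hcpD hs, hu, by omega, by omega⟩

/-- There is one group per point of `cp`, and its pick stays less than `θ` from that point. Picks
thus keep the order of `cp`, so the `i`-th pick belongs to the `i`-th point. -/
theorem IsSelection.exists_card_eq_and_abs_sub_le {S : ℕ → ℝ} {D cp T : Finset ℕ} {θ : ℕ}
    (hcpD : cp ⊆ D) (hnear : ∀ t ∈ D, ∃ s ∈ cp, t < s + θ ∧ s < t + θ)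
    (hsep : ∀ s ∈ cp, ∀ t ∈ cp, s < t → s + 4 * θ ≤ t) {B : ℝ}
    (hB : ∀ s ∈ cp, ∀ t ∈ D, t < s + θ → s < t + θ → S s ≤ S t → |(t : ℝ) - s| ≤ B)
    (hT : IsSelection S D θ T) :
    ∃ hcard : T.card = cp.card, ∀ i : Fin cp.card,
      |(T.orderEmbOfFin hcard i : ℝ) - (cp.orderEmbOfFin rfl i : ℝ)| ≤ min B θ := by
  classical
  obtain ⟨pick, hpick, rfl⟩ := hT
  set N : ℕ → Finset ℕ := fun s => D.filter fun u => u < s + θ ∧ s < u + θ with hN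
  have hself : ∀ s ∈ cp, s < s + θ ∧ s < s + θ := fun s hs => by
    obtain ⟨s', _, h⟩ := hnear s (hcpD hs)
    omega
  have hgroups : groups D θ = cp.image N := by
    ext g
    simp only [groups, Finset.mem_image]
    constructor
    · rintro ⟨t, ht, rfl⟩
      obtain ⟨s, hs, hst⟩ := hnear t ht
      exact ⟨s, hs, (groupOf_eq_filter hcpD hnear hsep hs ht hst).symm⟩
    · rintro ⟨s, hs, rfl⟩
      exact ⟨s, hcpD hs, groupOf_eq_filter hcpD hnear hsep hs (hcpD hs) (hself s hs)⟩
  have hq : ∀ s ∈ cp, pick (N s) ∈ N s ∧ ∀ u ∈ N s, S u ≤ S (pick (N s)) := fun s hs =>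
    hpick _ (by rw [hgroups]; exact Finset.mem_image_of_mem _ hs)
  have hqN : ∀ s ∈ cp, pick (N s) ∈ D ∧ pick (N s) < s + θ ∧ s < pick (N s) + θ := fun s hs => by
    simpa only [hN, Finset.mem_filter] using (hq s hs).1
  have hmono : ∀ s ∈ cp, ∀ t ∈ cp, s < t → pick (N s) < pick (N t) := fun s hs t ht hst => by
    have h1 := hqN s hs
    have h2 := hqN t ht
    have h3 := hsep s hs t ht hst
    omega
  have himage : (groups D θ).image pick = cp.image fun s => pick (N s) := by
    rw [hgroups, Finset.image_image]
    rfl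
  have hcard : ((groups D θ).image pick).card = cp.card := by
    rw [himage, Finset.card_image_of_injOn]
    intro s hs t ht hst
    by_contra hne
    rcases lt_or_gt_of_ne hne with h | h
    · exact (hmono s hs t ht h).ne hst
    · exact (hmono t ht s hs h).ne' hst
  have hmem : ∀ i, cp.orderEmbOfFin rfl i ∈ cp := fun i => Finset.orderEmbOfFin_mem cp rfl i
  have hunique := Finset.orderEmbOfFin_unique hcard
    (f := fun i => pick (N (cp.orderEmbOfFin rfl i)))
    (fun i => by rw [himage]; exact Finset.mem_image_of_mem _ (hmem i))
    (fun i j hij => hmono _ (hmem i) _ (hmem j) ((cp.orderEmbOfFin rfl).strictMono hij))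
  refine ⟨hcard, fun i => ?_⟩
  rw [← congrFun hunique i]
  set s := cp.orderEmbOfFin rfl i with hs
  obtain ⟨h1, h2, h3⟩ := hqN s (hmem i)
  refine le_min (hB s (hmem i) _ h1 h2 h3 ((hq s (hmem i)).2 s ?_)) ?_
  · exact Finset.mem_filter.2 ⟨hcpD (hmem i), hself s (hmem i)⟩
  · have h4 : ((pick (N s) : ℕ) : ℝ) < s + θ := by exact_mod_cast h2
    have h5 : (s : ℝ) < pick (N s) + θ := by exact_mod_cast h3
    rw [abs_le]
    constructor <;> linarith

end Selection

/-! ### Window means of a piecewise constant signal -/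

section Windows

variable {p n θ : ℕ} {X : ℕ → Vec p}

theorem windowMean_add (Y Z : ℕ → Vec p) (i : ℕ) :
    windowMean θ (fun t => Y t + Z t) i = windowMean θ Y i + windowMean θ Z i := by
  simp only [windowMean, Finset.sum_add_distrib, smul_add]

/-- Here `k` is the number of window indices from `m` on, so `k/θ` is the weight of the second
value. -/
theorem windowMean_eq_of_forall (hθ : 1 ≤ θ) {i m k : ℕ} {x y : Vec p} (hk : m + k = i + θ)
    (him : i ≤ m) (hx : ∀ s, i ≤ s → s < m → X s = x) (hy : ∀ s, m ≤ s → s < i + θ → X s = y) :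
    windowMean θ X i = x + ((k : ℝ) / θ) • (y - x) := by
  have hθ0 : (θ : ℝ) ≠ 0 := by positivity
  obtain ⟨l, rfl⟩ := Nat.exists_eq_add_of_le him
  have hl : (l : ℝ) = θ - k := by
    rw [eq_sub_iff_add_eq]
    exact_mod_cast (by omega : l + k = θ)
  rw [windowMean, ← Finset.sum_Ico_consecutive X him (by omega : i + l ≤ i + θ),
    Finset.sum_congr rfl fun s hs => hx s (Finset.mem_Ico.1 hs).1 (Finset.mem_Ico.1 hs).2,
    Finset.sum_congr rfl fun s hs => hy s (Finset.mem_Ico.1 hs).1 (Finset.mem_Ico.1 hs).2,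
    Finset.sum_const, Finset.sum_const, Nat.card_Ico, Nat.card_Ico, Nat.add_sub_cancel_left,
    show i + θ - (i + l) = k by omega, ← Nat.cast_smul_eq_nsmul ℝ, ← Nat.cast_smul_eq_nsmul ℝ, hl]
  ext j
  simp only [PiLp.smul_apply, PiLp.add_apply, PiLp.sub_apply, smul_eq_mul]
  field_simp
  ring

theorem windowMean_eq_of_const (hθ : 1 ≤ θ) {i : ℕ} {x : Vec p}
    (hx : ∀ s, i ≤ s → s < i + θ → X s = x) : windowMean θ X i = x := by
  rw [windowMean_eq_of_forall hθ (k := 0) (m := i + θ) rfl (by omega) hx (y := x) (fun s _ _ => by omega)]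
  simp

theorem eq_of_forall_notMem_changePoints {a b : ℕ} (ha : 1 ≤ a) (hb : b ≤ n)
    (h : ∀ s, a ≤ s → s < b → s ∉ changePoints X n) {s t : ℕ} (has : a ≤ s) (hst : s ≤ t)
    (htb : t ≤ b) : X s = X t := by
  induction t, hst using Nat.le_induction with
  | base => rfl
  | succ t hst ih =>
    rw [ih (by omega)]
    have h1 := h t (by omega) (by omega)
    by_contra hne
    exact h1 (Finset.mem_filter.2 ⟨Finset.mem_Ico.2 ⟨by omega, by omega⟩, hne⟩)

end Windows

/-! ### Deterministic analysis of the statistic -/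

section Detection

open scoped Pointwise

variable {p n θ : ℕ} {X e : ℕ → Vec p} {C : Set (Vec p)} {lam b γ Δ : ℝ}

/-- Nonexpansiveness replaces each window's mean signal by a reference value at the cost of the
bias; the denoising bound then controls the noise. -/
theorem abs_diffStat_sub_lt (hC : Convex ℝ C) (h0 : (0 : Vec p) ∈ interior C) (hlam : 0 ≤ lam)
    {t : ℕ} (hsmall : smallNoise C X e θ lam b t) :
    |diffStat C θ lam (fun s => X s + e s) t - ‖X (t + 1) - X t‖|
      < b + ‖windowMean θ X (t + 1) - X (t + 1)‖ + ‖windowMean θ X (t + 1 - θ) - X t‖ := by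
  have hdev : ∀ i x, ‖denoised C θ lam (fun s => X s + e s) i - x‖
      ≤ ‖windowMean θ X i - x‖ + Metric.infDist (windowMean θ e i) (lam • subdiff (gauge C) x) := by
    intro i x
    have h1 := norm_prox_sub_prox_le hC h0 hlam (windowMean θ (fun s => X s + e s) i)
      (x + windowMean θ e i)
    have h2 := norm_prox_sub_le_infDist hC h0 hlam x (windowMean θ e i)
    rw [windowMean_add, add_sub_add_right_eq_sub] at h1
    rw [denoised, windowMean_add]
    exact (norm_sub_le_norm_sub_add_norm_sub _ _ _).trans (add_le_add h1 h2)
  have h1 := hdev (t + 1) (X (t + 1))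
  have h2 := hdev (t + 1 - θ) (X t)
  have h3 : |diffStat C θ lam (fun s => X s + e s) t - ‖X (t + 1) - X t‖|
      ≤ ‖denoised C θ lam (fun s => X s + e s) (t + 1) - X (t + 1)‖
        + ‖denoised C θ lam (fun s => X s + e s) (t + 1 - θ) - X t‖ := by
    refine (abs_norm_sub_norm_le _ _).trans ?_
    rw [sub_sub_sub_comm]
    exact norm_sub_le _ _
  unfold smallNoise at hsmall
  linarith

/-- The two windows cover `t + 1 - θ, …, t + θ`; a jump between two of these indices is exactly a
change-point less than `θ` from `t`. -/
theorem diffStat_lt_of_far (hC : Convex ℝ C) (h0 : (0 : Vec p) ∈ interior C) (hlam : 0 ≤ lam)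
    (hθ : 1 ≤ θ) {t : ℕ} (h1 : θ ≤ t) (h2 : t + θ ≤ n)
    (hfar : ∀ s ∈ changePoints X n, ¬ (t < s + θ ∧ s < t + θ))
    (hsmall : smallNoise C X e θ lam b t) :
    diffStat C θ lam (fun s => X s + e s) t < b := by
  have hconst : ∀ s u, t + 1 - θ ≤ s → s ≤ u → u ≤ t + θ → X s = X u := fun s u hs hsu hu =>
    eq_of_forall_notMem_changePoints (a := t + 1 - θ) (b := t + θ) (n := n) (by omega) h2
      (fun v hv hv' hmem => hfar v hmem ⟨by omega, by omega⟩) hs hsu hu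
  have h := abs_diffStat_sub_lt hC h0 hlam hsmall
  rw [windowMean_eq_of_const hθ (x := X (t + 1))
      fun s hs hs' => (hconst (t + 1) s (by omega) hs (by omega)).symm,
    windowMean_eq_of_const hθ (x := X t) fun s hs hs' => hconst s t hs (by omega) (by omega),
    hconst t (t + 1) (by omega) (by omega) (by omega), sub_self, norm_zero] at h
  linarith [(abs_lt.1 h).2]

theorem eq_before_of_mem_changePoints
    (hsep : ∀ s ∈ changePoints X n, ∀ t ∈ changePoints X n, s < t → s + 4 * θ ≤ t)
    {s u : ℕ} (hs : s ∈ changePoints X n) (hu : 1 ≤ u)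
    (h : s ≤ u + 2 * θ) (hus : u ≤ s) : X u = X s := by
  have hsn : s < n := (Finset.mem_Ico.1 (Finset.mem_filter.1 hs).1).2
  refine eq_of_forall_notMem_changePoints (n := n) (a := u) (b := s) hu (by omega)
    (fun v hv hv' hmem => ?_) le_rfl hus le_rfl
  have := hsep v hmem s hs hv'
  omega

theorem eq_after_of_mem_changePoints
    (hsep : ∀ s ∈ changePoints X n, ∀ t ∈ changePoints X n, s < t → s + 4 * θ ≤ t)
    {s u : ℕ} (hs : s ∈ changePoints X n) (hu : u ≤ n)
    (h : u ≤ s + 2 * θ) (hus : s + 1 ≤ u) : X u = X (s + 1) := by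
  refine (eq_of_forall_notMem_changePoints (n := n) (a := s + 1) (b := u) (by omega) hu
    (fun v hv hv' hmem => ?_) le_rfl hus le_rfl).symm
  have := hsep s hs v hmem (by omega)
  omega

theorem lt_diffStat_of_mem_changePoints
    (hC : Convex ℝ C) (h0 : (0 : Vec p) ∈ interior C) (hlam : 0 ≤ lam)
    (hθ : 1 ≤ θ)
    (hsep : ∀ s ∈ changePoints X n, ∀ t ∈ changePoints X n, s < t → s + 4 * θ ≤ t)
    {s : ℕ} (hs : s ∈ changePoints X n) (h1 : θ ≤ s)
    (h2 : s + θ ≤ n) (hsmall : smallNoise C X e θ lam b s) :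
    ‖X s - X (s + 1)‖ - b < diffStat C θ lam (fun s => X s + e s) s := by
  have h := abs_diffStat_sub_lt hC h0 hlam hsmall
  rw [windowMean_eq_of_const hθ (x := X (s + 1)) fun u hu hu' =>
      eq_after_of_mem_changePoints hsep hs (by omega) (by omega) hu,
    windowMean_eq_of_const hθ (x := X s) fun u hu hu' =>
      eq_before_of_mem_changePoints hsep hs (by omega) (by omega) (by omega),
    sub_self, sub_self, norm_zero, norm_sub_rev] at h
  linarith [(abs_lt.1 h).1]

/-- Near a change-point, the statistic decreases linearly, up to the noise. -/
theorem diffStat_lt_of_near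
    (hC : Convex ℝ C) (h0 : (0 : Vec p) ∈ interior C) (hlam : 0 ≤ lam)
    (hθ : 1 ≤ θ)
    (hsep : ∀ s ∈ changePoints X n, ∀ t ∈ changePoints X n, s < t → s + 4 * θ ≤ t)
    {s t : ℕ} (hs : s ∈ changePoints X n) (h1 : θ ≤ t)
    (h2 : t + θ ≤ n) (hts : t < s + θ) (hst : s < t + θ) (hne : t ≠ s)
    (hsmall : smallNoise C X e θ lam b t) :
    diffStat C θ lam (fun s => X s + e s) t
      < b + (1 - |(t : ℝ) - s| / θ) * ‖X s - X (s + 1)‖ := by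
  have hθ0 : (0 : ℝ) < θ := by exact_mod_cast hθ
  have h := abs_diffStat_sub_lt hC h0 hlam hsmall
  have hbefore := fun {u} => eq_before_of_mem_changePoints (u := u) hsep hs
  have hafter := fun {u} => eq_after_of_mem_changePoints (u := u) hsep hs
  rcases lt_or_gt_of_ne hne with hlt | hgt
  -- Before `s` both reference values equal `X s`, and only the right window straddles the jump,
  -- with `t + θ - s` indices past it.
  · have hk : (t + θ - s : ℕ) = (θ : ℝ) - |(t : ℝ) - s| := by
      have : (t : ℝ) < s := by exact_mod_cast hlt
      rw [Nat.cast_sub (by omega), abs_of_neg (by linarith)]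
      push_cast
      ring
    rw [hbefore (u := t + 1) (by omega) (by omega) (by omega),
      hbefore (u := t) (by omega) (by omega) (by omega),
      windowMean_eq_of_const hθ (i := t + 1 - θ) (x := X s) fun u hu hu' =>
        hbefore (by omega) (by omega) (by omega),
      windowMean_eq_of_forall hθ (i := t + 1) (m := s + 1) (k := t + θ - s) (x := X s)
        (y := X (s + 1)) (by omega) (by omega)
        (fun u hu hu' => hbefore (by omega) (by omega) (by omega))
        (fun u hu hu' => hafter (by omega) (by omega) (by omega)),
      sub_self, norm_zero, add_sub_cancel_left, norm_smul, hk,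
      Real.norm_of_nonneg (by rw [← hk]; positivity), norm_sub_rev (X (s + 1)), sub_div,
      div_self hθ0.ne'] at h
    linarith [(abs_lt.1 h).2]
  -- After `s` the left window straddles the jump; its reference value is `X (s + 1)`, so the bias
  -- comes from the `θ - (t - s)` indices up to `s`.
  · have hk : (t - s : ℕ) = |(t : ℝ) - s| := by
      have : (s : ℝ) < t := by exact_mod_cast hgt
      rw [Nat.cast_sub (by omega), abs_of_pos (by linarith)]
    have hle : |(t : ℝ) - s| ≤ θ := by
      rw [← hk]
      exact_mod_cast (by omega : t - s ≤ θ)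
    rw [hafter (u := t + 1) (by omega) (by omega) (by omega),
      hafter (u := t) (by omega) (by omega) (by omega),
      windowMean_eq_of_const hθ (i := t + 1) (x := X (s + 1)) fun u hu hu' =>
        hafter (by omega) (by omega) (by omega),
      windowMean_eq_of_forall hθ (i := t + 1 - θ) (m := s + 1) (k := t - s) (x := X s)
        (y := X (s + 1)) (by omega) (by omega)
        (fun u hu hu' => hbefore (by omega) (by omega) (by omega))
        (fun u hu hu' => hafter (by omega) (by omega) (by omega)),
      sub_self, norm_zero, hk,
      show X s + (|(t : ℝ) - s| / θ) • (X (s + 1) - X s) - X (s + 1)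
        = (1 - |(t : ℝ) - s| / θ) • (X s - X (s + 1)) by
          rw [sub_smul, one_smul, ← neg_sub (X s) (X (s + 1)), smul_neg]
          abel,
      norm_smul, Real.norm_of_nonneg (by rw [sub_nonneg, div_le_one hθ0]; exact hle)] at h
    linarith [(abs_lt.1 h).2]

/-- If the noise is small at all indices, the output of the algorithm is accurate. -/
theorem IsOutput.exists_card_eq_and_abs_sub_le
    (hC : Convex ℝ C) (h0 : (0 : Vec p) ∈ interior C) (hlam : 0 ≤ lam)
    (hθ : 1 ≤ θ)
    (hsep : ∀ s ∈ changePoints X n, ∀ t ∈ changePoints X n, s < t → s + 4 * θ ≤ t)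
    (hends : ∀ t ∈ changePoints X n, θ ≤ t ∧ t + θ ≤ n)
    (hΔ : ∀ t ∈ changePoints X n, Δ ≤ ‖X t - X (t + 1)‖)
    (hbγ : b ≤ γ) (hγΔ : γ ≤ Δ / 2)
    (hsmall : ∀ t, θ ≤ t → t + θ ≤ n → smallNoise C X e θ lam b t) {T : Finset ℕ}
    (hT : IsOutput C n θ γ lam (fun t => X t + e t) T) :
    ∃ hcard : T.card = (changePoints X n).card, ∀ i : Fin (changePoints X n).card,
      |(T.orderEmbOfFin hcard i : ℝ) - ((changePoints X n).orderEmbOfFin rfl i : ℝ)|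
        ≤ min (2 * b * θ / Δ) θ := by
  have hθ0 : (0 : ℝ) < θ := by exact_mod_cast hθ
  -- Strictness in `smallNoise` forces `b > 0`, hence `γ > 0` and `Δ > 0`: peaks are nonzero and
  -- division by `Δ` is legitimate.
  have hb : ∀ t, smallNoise C X e θ lam b t → 0 < b := fun t ht =>
    (add_nonneg Metric.infDist_nonneg Metric.infDist_nonneg).trans_lt ht
  set Y : ℕ → Vec p := fun t => X t + e t with hY
  have hpeak : ∀ s ∈ changePoints X n, γ < diffStat C θ lam Y s := fun s hs => by
    have h := hends s hs
    have h1 := lt_diffStat_of_mem_changePoints hC h0 hlam hθ hsep hs h.1 h.2 (hsmall s h.1 h.2)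
    linarith [hΔ s hs]
  have hpeak' : ∀ s ∈ changePoints X n, threshStat C θ γ lam Y s = diffStat C θ lam Y s :=
    fun s hs => by
      rw [threshStat, if_neg (not_lt.2 (hpeak s hs).le)]
  have hD : ∀ t, t ∈ nonzeroIdx (threshStat C θ γ lam Y) n θ ↔
      (θ ≤ t ∧ t + θ ≤ n) ∧ threshStat C θ γ lam Y t ≠ 0 := fun t => by
    simp only [nonzeroIdx, Finset.mem_filter, Finset.mem_Icc]
    refine and_congr_left fun _ => ?_
    omega
  have hnz : ∀ t, threshStat C θ γ lam Y t ≠ 0 →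
      ¬ diffStat C θ lam Y t < γ ∧ threshStat C θ γ lam Y t = diffStat C θ lam Y t := fun t ht => by
    unfold threshStat at ht ⊢
    split_ifs at ht ⊢ with h
    · exact absurd rfl ht
    · exact ⟨h, rfl⟩
  refine IsSelection.exists_card_eq_and_abs_sub_le (fun s hs => ?_) (fun t ht => ?_) hsep
    (fun s hs t ht hts hst hle => ?_) hT
  · have h := hends s hs
    refine (hD s).2 ⟨h, ?_⟩
    rw [hpeak' s hs]
    exact (by linarith [hpeak s hs, hb s (hsmall s h.1 h.2)] : 0 < diffStat C θ lam Y s).ne'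
  · obtain ⟨⟨h1, h2⟩, h3⟩ := (hD t).1 ht
    by_contra! hfar
    exact (hnz t h3).1 ((diffStat_lt_of_far hC h0 hlam hθ h1 h2
      (fun s hs h => absurd h.2 (not_lt.2 (hfar s hs h.1))) (hsmall t h1 h2)).trans_le hbγ)
  · obtain ⟨⟨h1, h2⟩, h3⟩ := (hD t).1 ht
    have hb0 := hb t (hsmall t h1 h2)
    have hΔ0 : 0 < Δ := by linarith
    rcases eq_or_ne t s with rfl | hne
    · rw [sub_self, abs_zero]
      positivity
    rw [hpeak' s hs, (hnz t h3).2] at hle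
    have h4 := hends s hs
    have h5 := lt_diffStat_of_mem_changePoints hC h0 hlam hθ hsep hs h4.1 h4.2
      (hsmall s h4.1 h4.2)
    have h6 := diffStat_lt_of_near hC h0 hlam hθ hsep hs h1 h2 hts hst hne (hsmall t h1 h2)
    -- Chain the lower bound at `s`, the comparison `S s ≤ S t` and the upper bound at `t`; the full
    -- jump cancels and leaves its fraction `|t - s|/θ`.
    have h7 : |(t : ℝ) - s| / θ * Δ ≤ 2 * b := by
      have h8 := mul_le_mul_of_nonneg_left (hΔ s hs)
        (by positivity : 0 ≤ |(t : ℝ) - s| / θ)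
      linarith
    rw [le_div_iff₀ hΔ0]
    calc |(t : ℝ) - s| * Δ = |(t : ℝ) - s| / θ * Δ * θ := by field_simp
      _ ≤ 2 * b * θ := by gcongr

end Detection

end ChangePoint

theorem theorem1 {Ω : Type*} [MeasurableSpace Ω] (μ : Measure Ω) [IsProbabilityMeasure μ]
    (p n : ℕ) (hn : 1 ≤ n) (σ : ℝ) (hσ : 0 < σ)
    (X : ℕ → ChangePoint.Vec p) (ε : ℕ → Ω → ChangePoint.Vec p)
    (hlaw : ∀ t ∈ Set.Icc 1 n, HasLaw (ε t) (multivariateGaussian 0 (σ ^ 2 • 1)) μ)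
    (hindep : iIndepFun (fun t : Set.Icc 1 n => ε t) μ)
    -- the convex set
    (C : Set (ChangePoint.Vec p)) (hC : Convex ℝ C) (hC0 : (0 : ChangePoint.Vec p) ∈ interior C)
    -- the smallest change and the smallest distance between two change-points
    (Δ : ℝ) (hΔ : (ChangePoint.changePoints X n).Nonempty → IsLeast (ChangePoint.jumpSizes X n) Δ)
    (T : ℕ) (hT : 2 ≤ (ChangePoint.changePoints X n).card →
      IsLeast (ChangePoint.changeGaps X n) T)
    (r : ℝ) (hr : 1 < r)
    (hΔT : 64 * σ ^ 2 * (ChangePoint.gaussianDistance C X n + r * √(2 * Real.log n)) ^ 2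
      ≤ Δ ^ 2 * T)
    (hends : ∀ t ∈ ChangePoint.changePoints X n, (T : ℝ) / 4 ≤ t ∧ (t : ℝ) ≤ n - (T : ℝ) / 4)
    -- the parameters of the algorithm
    (θ : ℕ) (hθ : 1 ≤ θ) (hθT : (θ : ℝ) ≤ (T : ℝ) / 4)
    (γ : ℝ) (hγΔ : γ ≤ Δ / 2)
    (hγ : 2 * (σ / √θ) * (ChangePoint.gaussianDistance C X n + r * √(2 * Real.log n)) ≤ γ)
    (lam₀ : ℝ) (hlam₀ : 0 ≤ lam₀)
    (hmin : IsMinOn (ChangePoint.maxExpDist C X n) (Set.Ici 0) lam₀)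
    (lam : ℝ) (hlam : lam = σ / √θ * lam₀) :
    1 - 5 * (n : ℝ) ^ (1 - r ^ 2) <
      μ.real {ω | ∀ That : Finset ℕ,
        ChangePoint.IsOutput C n θ γ lam (fun t => X t + ε t ω) That →
          ∃ hcard : That.card = (ChangePoint.changePoints X n).card,
            ∀ i : Fin (ChangePoint.changePoints X n).card,
              |(That.orderEmbOfFin hcard i : ℝ)
                  - ((ChangePoint.changePoints X n).orderEmbOfFin rfl i : ℝ)|
                ≤ min ((4 * r * √(Real.log n) / ChangePoint.gaussianDistance C X n + 4)
                    * (σ * ChangePoint.gaussianDistance C X n / Δ) * √θ) θ} := by 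
  set η := ChangePoint.gaussianDistance C X n with hη
  set L := Real.log n with hL
  have hL0 : 0 ≤ L := Real.log_nonneg (by exact_mod_cast hn)
  have hθ0 : (0 : ℝ) < θ := by exact_mod_cast hθ
  have hn0 : (0 : ℝ) < n := by exact_mod_cast hn
  have hc : 0 < σ / √θ := by positivity
  have h4θ : 4 * θ ≤ T := by
    have : (4 * θ : ℝ) ≤ T := by linarith
    exact_mod_cast this
  have hsep : ∀ s ∈ ChangePoint.changePoints X n, ∀ t ∈ ChangePoint.changePoints X n,
      s < t → s + 4 * θ ≤ t := fun s hs t ht hst => by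
    have h1 := (hT (Finset.one_lt_card.2 ⟨s, hs, t, ht, hst.ne⟩)).2 ⟨s, hs, t, ht, hst, rfl⟩
    omega
  have hends' : ∀ t ∈ ChangePoint.changePoints X n, θ ≤ t ∧ t + θ ≤ n := fun t ht => by
    obtain ⟨h1, h2⟩ := hends t ht
    have h3 : (θ : ℝ) ≤ t := by linarith
    have h4 : (t : ℝ) + θ ≤ n := by linarith
    exact ⟨by exact_mod_cast h3, by exact_mod_cast h4⟩
  have hΔ' : ∀ t ∈ ChangePoint.changePoints X n, Δ ≤ ‖X t - X (t + 1)‖ := fun t ht =>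
    (hΔ ⟨t, ht⟩).2 (Set.mem_image_of_mem _ ht)
  have hbγ : σ / √θ * (2 * η + 2 * r * √L) ≤ γ := by
    refine le_trans ?_ hγ
    have h1 : √L ≤ √(2 * L) := Real.sqrt_le_sqrt (by linarith)
    calc σ / √θ * (2 * η + 2 * r * √L) ≤ σ / √θ * (2 * η + 2 * r * √(2 * L)) := by gcongr
      _ = _ := by ring
  have hprob := ChangePoint.le_measureReal_forall_smallNoise (C := C) hn hσ hlaw hindep hθ hlam₀
    hmin (r := r) (by linarith)
  have hpow : 0 < (n : ℝ) ^ (1 - r ^ 2) := Real.rpow_pos_of_pos hn0 _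
  refine (by linarith : 1 - 5 * (n : ℝ) ^ (1 - r ^ 2) < 1 - (n : ℝ) ^ (1 - r ^ 2)).trans_le
    (hprob.trans (measureReal_mono fun ω hω That hThat => ?_))
  rw [← hlam] at hω
  obtain ⟨hcard, hbound⟩ := ChangePoint.IsOutput.exists_card_eq_and_abs_sub_le hC hC0
    (hlam ▸ by positivity) hθ hsep hends' hΔ' hbγ hγΔ hω hThat
  refine ⟨hcard, fun i => (hbound i).trans (min_le_min_right _ (le_of_eq ?_))⟩
  -- The target bound divides by `η`. A change-point exists here, since `i` indexes one, so the
  -- dimension is positive and `expDist_pos` yields `η > 0`.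
  have hp : 0 < p := by
    refine Nat.pos_of_ne_zero fun hp => ?_
    subst hp
    exact (Finset.mem_filter.1 (Finset.orderEmbOfFin_mem _ rfl i)).2 (Subsingleton.elim _ _)
  have hη0 : η ≠ 0 := by
    refine ne_of_gt ?_
    rw [hη, ChangePoint.gaussianDistance_eq hlam₀ hmin]
    exact (ChangePoint.expDist_pos hp hC hC0 (X 1) hlam₀).trans_le
      (ChangePoint.expDist_le_maxExpDist ⟨le_rfl, hn⟩ lam₀)
  have hsq : (θ : ℝ) = √θ * √θ := (Real.mul_self_sqrt hθ0.le).symm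
  calc 2 * (σ / √θ * (2 * η + 2 * r * √L)) * θ / Δ
      = 2 * (σ / √θ * (2 * η + 2 * r * √L)) * (√θ * √θ) / Δ := by rw [← hsq]
    _ = _ := by
      field_simp
      ring
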